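/- Let $A$ be an associative ring with unit and $C$ an $A$-coring, i.e. an $A$-bimodule with an $A$-bilinear coassociative comultiplication $\Delta:C\to C\otimes_A C$, $\Delta(c)=c_{(1)}\otimes c_{(2)}$, and an $A$-bilinear counit $\varepsilon:C\to A$. Let ${}^*C={}_A\mathrm{Hom}(C,A)$ with product $(f*g)(c)=g(c_{(1)}f(c_{(2)}))$ and $C^*=\mathrm{Hom}_A(C,A)$ with product $(f*g)(c)=f(g(c_{(1)})c_{(2)})$; both are rings with unit $\varepsilon$. $C$ is a right ${}^*C$-module by $c\cdot f=c_{(1)}f(c_{(2)})$ and a left $C^*$-module by $f\cdot c=f(c_{(1)})c_{(2)}$. Let $\mathcal M^C$ and ${}^C\mathcal M$ be the categories of right and of left $C$-comodules. Let $Q$ be the left ${}^*C$-module of all right $A$-linear maps $q:C\to{}^*C$ with $q(x_{(1)})(c)\,x_{(2)}=c_{(1)}\,q(x)(c_{(2)})$ for all $x,c\in C$ (action $(fq)(x)=f*q(x)$), and let $$\triangledown:C\otimes_{{}^*C}Q\to \mathrm{End}^C(C)\ (\cong C^*),\qquad \triangledown(x\otimes q)(y)=x_{(1)}\,q(y)(x_{(2)})$$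 be the corresponding map of the Morita context of the right comodule $C$. Suppose that $C$ is finitely generated and projective as a left $A$-module. Then the following statements are equivalent. 1. $C$ is, as a right ${}^*C$-module, a direct summand of a finite number of copies of ${}^*C$ (that is, $C$ is left $k$-quasi-Frobenius). 2. $C$ is finitely generated and projective as a right $A$-module, and any one of the following conditions holds (each of them, together with this finiteness condition, is equivalent to 1): - (i) the map $\triangledown$ is surjective (equivalently, bijective); - (ii) the functor $-\otimes_{C^*}C:\mathcal M_{C^*}\to\mathcal M^C$ is fully faithful; - (iii) $C$ is a generator in ${}^C\mathcal M$; - (iv) $C$ is flat as a right ${}^*C$-module; - (v) the functor ${}^C\mathrm{Hom}(C,-):{}^C\mathcal M\to{}_{{}^*C}\mathcal M$ is fully faithful, where ${}^*C$ acts by $(f\varphi)(c)=\varphi(c\cdot f)$. -/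

import Mathlib

open CategoryTheory MulOpposite

universe u

/-! ## Tensor products over a noncommutative ring

Right `R`-modules are modules over `Rᵐᵒᵖ`: the element `m r` is `op r • m`. -/

/-- The subgroup of `M ⊗[ℤ] N` generated by all `m r ⊗ n - m ⊗ r n`. -/
def NCTensor.rel (R M N : Type*) [Ring R] [AddCommGroup M] [AddCommGroup N]
    [Module Rᵐᵒᵖ M] [Module R N] : AddSubgroup (TensorProduct ℤ M N) :=
  AddSubgroup.closure {t | ∃ (m : M) (r : R) (n : N),
    t = TensorProduct.tmul ℤ (op r • m) n - TensorProduct.tmul ℤ m (r • n)}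

/-- The tensor product `M ⊗_R N` of a right `R`-module `M` and a left `R`-module `N`, as an
abelian group. -/
def NCTensor (R M N : Type*) [Ring R] [AddCommGroup M] [AddCommGroup N]
    [Module Rᵐᵒᵖ M] [Module R N] : Type _ :=
  TensorProduct ℤ M N ⧸ NCTensor.rel R M N

namespace NCTensor

section basic

variable (R : Type*) {M N P : Type*} [Ring R] [AddCommGroup M] [AddCommGroup N]
  [Module Rᵐᵒᵖ M] [Module R N] [AddCommGroup P]

instance : AddCommGroup (NCTensor R M N) :=
  inferInstanceAs (AddCommGroup (TensorProduct ℤ M N ⧸ NCTensor.rel R M N))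

/-- The pure tensor `m ⊗_R n`. -/
def tmul (m : M) (n : N) : NCTensor R M N :=
  QuotientAddGroup.mk' (NCTensor.rel R M N) (TensorProduct.tmul ℤ m n)

theorem add_tmul (m m' : M) (n : N) : tmul R (m + m') n = tmul R m n + tmul R m' n := by
  simp only [tmul, TensorProduct.add_tmul, map_add]; rfl

theorem tmul_add (m : M) (n n' : N) : tmul R m (n + n') = tmul R m n + tmul R m n' := by
  simp only [tmul, TensorProduct.tmul_add, map_add]; rfl

theorem smul_tmul (r : R) (m : M) (n : N) : tmul R (op r • m) n = tmul R m (r • n) := by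
  refine (QuotientAddGroup.mk'_eq_mk' _).2
    ⟨-(TensorProduct.tmul ℤ (op r • m) n - TensorProduct.tmul ℤ m (r • n)), ?_, by abel⟩
  exact neg_mem (AddSubgroup.subset_closure ⟨m, r, n, rfl⟩)

/-- `tmul` as a biadditive map. -/
def mkHom : M →+ N →+ NCTensor R M N :=
  AddMonoidHom.mk' (fun m => AddMonoidHom.mk' (fun n => tmul R m n) (tmul_add R m))
    fun m m' => by ext n; exact add_tmul R m m' n

@[simp] theorem mkHom_apply (m : M) (n : N) : mkHom R m n = tmul R m n := rfl

theorem zero_tmul (n : N) : tmul R (0 : M) n = 0 := by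
  rw [← mkHom_apply, map_zero]; rfl

theorem tmul_zero (m : M) : tmul R m (0 : N) = 0 := by
  rw [← mkHom_apply, map_zero]

variable {R}

/-- The additive map on `M ⊗_R N` induced by a biadditive `R`-balanced map. -/
def lift (f : M →+ N →+ P) (hf : ∀ (r : R) (m : M) (n : N), f (op r • m) n = f m (r • n)) :
    NCTensor R M N →+ P :=
  QuotientAddGroup.lift (NCTensor.rel R M N)
    (TensorProduct.liftAddHom f fun z m n => by
      rw [map_zsmul, map_zsmul, AddMonoidHom.zsmul_apply])
    (by
      refine (AddSubgroup.closure_le _).2 ?_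
      rintro _ ⟨m, r, n, rfl⟩
      simp [hf])

@[simp] theorem lift_tmul (f : M →+ N →+ P)
    (hf : ∀ (r : R) (m : M) (n : N), f (op r • m) n = f m (r • n)) (m : M) (n : N) :
    lift f hf (tmul R m n) = f m n := rfl

theorem induction {p : NCTensor R M N → Prop} (x : NCTensor R M N)
    (h0 : p 0) (ht : ∀ m n, p (tmul R m n)) (ha : ∀ x y, p x → p y → p (x + y)) : p x := by
  obtain ⟨t, rfl⟩ := QuotientAddGroup.mk'_surjective (NCTensor.rel R M N) x
  induction t using TensorProduct.induction_on with
  | zero => exact h0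
  | tmul m n => exact ht m n
  | add a b ha' hb' => rw [map_add]; exact ha _ _ ha' hb'

/-- Additive maps out of `M ⊗_R N` agree if they agree on pure tensors. -/
theorem hom_ext {f g : NCTensor R M N →+ P} (h : ∀ m n, f (tmul R m n) = g (tmul R m n)) :
    f = g := by
  ext x
  induction x using NCTensor.induction with
  | h0 => rw [map_zero, map_zero]
  | ht m n => exact h m n
  | ha x y hx hy => rw [map_add, map_add, hx, hy]

theorem hom_congr {f g : NCTensor R M N →+ P} (h : ∀ m n, f (tmul R m n) = g (tmul R m n))
    (x : NCTensor R M N) : f x = g x := by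
  rw [hom_ext h]

variable {M' N' : Type*} [AddCommGroup M'] [AddCommGroup N'] [Module Rᵐᵒᵖ M'] [Module R N']

/-- The map `f ⊗_R g`. -/
def tensorMap (f : M →ₗ[Rᵐᵒᵖ] M') (g : N →ₗ[R] N') : NCTensor R M N →+ NCTensor R M' N' :=
  lift (((mkHom R).compl₂ g.toAddMonoidHom).comp f.toAddMonoidHom) fun r m n => by
    simp [smul_tmul]

@[simp] theorem tensorMap_tmul (f : M →ₗ[Rᵐᵒᵖ] M') (g : N →ₗ[R] N') (m : M) (n : N) :
    tensorMap f g (tmul R m n) = tmul R (f m) (g n) := rfl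

theorem tensorMap_add_left (f g : M →ₗ[Rᵐᵒᵖ] M') (h : N →ₗ[R] N') (x : NCTensor R M N) :
    tensorMap (f + g) h x = tensorMap f h x + tensorMap g h x :=
  hom_congr (f := tensorMap (f + g) h) (g := tensorMap f h + tensorMap g h) (fun m n => by simp [add_tmul]) x

theorem tensorMap_add_right (f : M →ₗ[Rᵐᵒᵖ] M') (g h : N →ₗ[R] N') (x : NCTensor R M N) :
    tensorMap f (g + h) x = tensorMap f g x + tensorMap f h x :=
  hom_congr (f := tensorMap f (g + h)) (g := tensorMap f g + tensorMap f h) (fun m n => by simp [tmul_add]) x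

theorem tensorMap_neg_left (f : M →ₗ[Rᵐᵒᵖ] M') (h : N →ₗ[R] N') (x : NCTensor R M N) :
    tensorMap (-f) h x = -tensorMap f h x := by
  rw [eq_neg_iff_add_eq_zero, ← tensorMap_add_left, neg_add_cancel]
  exact hom_congr (f := tensorMap 0 h) (g := 0) (fun m n => by simp [zero_tmul]) x

theorem tensorMap_neg_right (f : M →ₗ[Rᵐᵒᵖ] M') (h : N →ₗ[R] N') (x : NCTensor R M N) :
    tensorMap f (-h) x = -tensorMap f h x := by
  rw [eq_neg_iff_add_eq_zero, ← tensorMap_add_right, neg_add_cancel]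
  exact hom_congr (f := tensorMap f 0) (g := 0) (fun m n => by simp [tmul_zero]) x

theorem tensorMap_id (x : NCTensor R M N) :
    tensorMap (LinearMap.id : M →ₗ[Rᵐᵒᵖ] M) (LinearMap.id : N →ₗ[R] N) x = x :=
  hom_congr (f := tensorMap LinearMap.id LinearMap.id) (g := AddMonoidHom.id _) (fun m n => by simp) x

theorem tensorMap_comp {M'' N'' : Type*} [AddCommGroup M''] [AddCommGroup N''] [Module Rᵐᵒᵖ M'']
    [Module R N''] (f : M →ₗ[Rᵐᵒᵖ] M') (f' : M' →ₗ[Rᵐᵒᵖ] M'') (g : N →ₗ[R] N')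
    (g' : N' →ₗ[R] N'') (x : NCTensor R M N) :
    tensorMap f' g' (tensorMap f g x) = tensorMap (f' ∘ₗ f) (g' ∘ₗ g) x :=
  hom_congr (f := (tensorMap f' g').comp (tensorMap f g)) (g := tensorMap (f' ∘ₗ f) (g' ∘ₗ g))
    (fun m n => by simp) x

end basic

section actions

variable {R : Type*} {M N : Type*} [Ring R] [AddCommGroup M] [AddCommGroup N]
  [Module Rᵐᵒᵖ M] [Module R N]

/-- If `M` is an `S`-`R`-bimodule, then `M ⊗_R N` is a left `S`-module: `s (m ⊗ n) = s m ⊗ n`. -/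
instance leftModule {S : Type*} [Ring S] [Module S M] [SMulCommClass S Rᵐᵒᵖ M] :
    Module S (NCTensor R M N) where
  smul s := lift ((mkHom R).comp (DistribSMul.toAddMonoidHom M s)) fun r m n => by
    simp [smul_comm s (op r) m, smul_tmul]
  one_smul := hom_congr (f := lift ((mkHom R).comp (DistribSMul.toAddMonoidHom M (1 : S)))
    fun r m n => by simp [smul_tmul]) (g := AddMonoidHom.id _) fun m n => by simp
  mul_smul a b := by
    have H : ∀ (s : S) (r : R) (m : M) (n : N),
        ((mkHom R).comp (DistribSMul.toAddMonoidHom M s)) (op r • m) n =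
        ((mkHom R).comp (DistribSMul.toAddMonoidHom M s)) m (r • n) := fun s r m n => by
      simp [smul_comm s (op r) m, smul_tmul]
    exact hom_congr (f := lift _ (H (a * b))) (g := (lift _ (H a)).comp (lift _ (H b)))
      fun m n => by simp [mul_smul]
  smul_zero s := map_zero (lift _ _)
  smul_add s := map_add (lift _ _)
  add_smul a b := by
    have H : ∀ (s : S) (r : R) (m : M) (n : N),
        ((mkHom R).comp (DistribSMul.toAddMonoidHom M s)) (op r • m) n =
        ((mkHom R).comp (DistribSMul.toAddMonoidHom M s)) m (r • n) := fun s r m n => by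
      simp [smul_comm s (op r) m, smul_tmul]
    exact hom_congr (f := lift _ (H (a + b))) (g := (lift _ (H a)) + (lift _ (H b)))
      fun m n => by simp [add_smul]
  zero_smul := by
    have H : ∀ (s : S) (r : R) (m : M) (n : N),
        ((mkHom R).comp (DistribSMul.toAddMonoidHom M s)) (op r • m) n =
        ((mkHom R).comp (DistribSMul.toAddMonoidHom M s)) m (r • n) := fun s r m n => by
      simp [smul_comm s (op r) m, smul_tmul]
    exact hom_congr (f := lift _ (H 0)) (g := 0) fun m n => by simp

/-- If `N` is an `R`-`S`-bimodule, then `M ⊗_R N` is a right `S`-module: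
`(m ⊗ n) s = m ⊗ n s`. -/
instance rightModule {S : Type*} [Ring S] [Module Sᵐᵒᵖ N] [SMulCommClass R Sᵐᵒᵖ N] :
    Module Sᵐᵒᵖ (NCTensor R M N) where
  smul s := lift ((mkHom R).compl₂ (DistribSMul.toAddMonoidHom N s)) fun r m n => by
    simp [← smul_comm r s n, smul_tmul]
  one_smul := hom_congr (f := lift ((mkHom R).compl₂ (DistribSMul.toAddMonoidHom N (1 : Sᵐᵒᵖ)))
    fun r m n => by simp [smul_tmul]) (g := AddMonoidHom.id _) fun m n => by simp
  mul_smul a b := by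
    have H : ∀ (s : Sᵐᵒᵖ) (r : R) (m : M) (n : N),
        ((mkHom R).compl₂ (DistribSMul.toAddMonoidHom N s)) (op r • m) n =
        ((mkHom R).compl₂ (DistribSMul.toAddMonoidHom N s)) m (r • n) := fun s r m n => by
      simp [← smul_comm r s n, smul_tmul]
    exact hom_congr (f := lift _ (H (a * b))) (g := (lift _ (H a)).comp (lift _ (H b)))
      fun m n => by simp [mul_smul]
  smul_zero s := map_zero (lift _ _)
  smul_add s := map_add (lift _ _)
  add_smul a b := by
    have H : ∀ (s : Sᵐᵒᵖ) (r : R) (m : M) (n : N),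
        ((mkHom R).compl₂ (DistribSMul.toAddMonoidHom N s)) (op r • m) n =
        ((mkHom R).compl₂ (DistribSMul.toAddMonoidHom N s)) m (r • n) := fun s r m n => by
      simp [← smul_comm r s n, smul_tmul]
    exact hom_congr (f := lift _ (H (a + b))) (g := (lift _ (H a)) + (lift _ (H b)))
      fun m n => by simp [add_smul, tmul_add]
  zero_smul := by
    have H : ∀ (s : Sᵐᵒᵖ) (r : R) (m : M) (n : N),
        ((mkHom R).compl₂ (DistribSMul.toAddMonoidHom N s)) (op r • m) n =
        ((mkHom R).compl₂ (DistribSMul.toAddMonoidHom N s)) m (r • n) := fun s r m n => by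
      simp [← smul_comm r s n, smul_tmul]
    exact hom_congr (f := lift _ (H 0)) (g := 0) fun m n => by simp [tmul_zero]

@[simp] theorem left_smul_tmul {S : Type*} [Ring S] [Module S M] [SMulCommClass S Rᵐᵒᵖ M]
    (s : S) (m : M) (n : N) : s • tmul R m n = tmul R (s • m) n := rfl

@[simp] theorem right_smul_tmul {S : Type*} [Ring S] [Module Sᵐᵒᵖ N] [SMulCommClass R Sᵐᵒᵖ N]
    (s : S) (m : M) (n : N) : op s • tmul R m n = tmul R m (op s • n) := rfl

end actions

section assoc

variable {R S : Type*} {M N P : Type*} [Ring R] [Ring S]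
  [AddCommGroup M] [AddCommGroup N] [AddCommGroup P]
  [Module Rᵐᵒᵖ M] [Module R N] [Module Sᵐᵒᵖ N] [SMulCommClass R Sᵐᵒᵖ N] [Module S P]

/-- The left `R`-linear map `N → N ⊗_S P`, `n ↦ n ⊗ p`. -/
def tmulConst (p : P) : N →ₗ[R] NCTensor S N P where
  toFun n := tmul S n p
  map_add' n n' := add_tmul S n n' p
  map_smul' _ _ := rfl

@[simp] theorem tmulConst_apply (p : P) (n : N) :
    (tmulConst p : N →ₗ[R] NCTensor S N P) n = tmul S n p := rfl

/-- The canonical isomorphism `(M ⊗_R N) ⊗_S P → M ⊗_R (N ⊗_S P)`,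
`(m ⊗ n) ⊗ p ↦ m ⊗ (n ⊗ p)`. -/
def assoc : NCTensor S (NCTensor R M N) P →+ NCTensor R M (NCTensor S N P) :=
  lift
    (AddMonoidHom.mk' (fun p => tensorMap (LinearMap.id : M →ₗ[Rᵐᵒᵖ] M) (tmulConst p))
      (fun p p' => hom_ext fun m n => by simp [tmul_add])).flip
    fun s x p => hom_congr
      (f := (tensorMap (LinearMap.id : M →ₗ[Rᵐᵒᵖ] M) (tmulConst p)).comp
        (DistribSMul.toAddMonoidHom (NCTensor R M N) (op s)))
      (g := tensorMap (LinearMap.id : M →ₗ[Rᵐᵒᵖ] M) (tmulConst (s • p)))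
      (fun m n => by simp [smul_tmul]) x

@[simp] theorem assoc_tmul (m : M) (n : N) (p : P) :
    assoc (tmul S (tmul R m n) p) = tmul R m (tmul S n p) := rfl

end assoc

section contract

variable {A : Type*} {M N : Type*} [Ring A] [AddCommGroup M] [AddCommGroup N]
  [Module Aᵐᵒᵖ M] [Module A N]

/-- For a left `A`-linear form `f` on `N`, the map `M ⊗_A N → M`, `m ⊗ n ↦ m f(n)`. -/
def contractRight (f : N →ₗ[A] A) : NCTensor A M N →+ M :=
  lift
    { toFun := fun m =>
        { toFun := fun n => op (f n) • m
          map_zero' := by simp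
          map_add' := fun n n' => by simp [add_smul] }
      map_zero' := by ext n; simp
      map_add' := fun m m' => by ext n; simp }
    fun r m n => by simp [mul_smul]

/-- For a right `A`-linear form `f` on `M`, the map `M ⊗_A N → N`, `m ⊗ n ↦ f(m) n`. -/
def contractLeft (f : M →ₗ[Aᵐᵒᵖ] A) : NCTensor A M N →+ N :=
  lift
    { toFun := fun m =>
        { toFun := fun n => f m • n
          map_zero' := by simp
          map_add' := fun n n' => by simp }
      map_zero' := by ext n; simp
      map_add' := fun m m' => by ext n; simp [add_smul] }
    fun r m n => by simp [mul_smul]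

@[simp] theorem contractRight_tmul (f : N →ₗ[A] A) (m : M) (n : N) :
    contractRight f (tmul A m n) = op (f n) • m := rfl

@[simp] theorem contractLeft_tmul (f : M →ₗ[Aᵐᵒᵖ] A) (m : M) (n : N) :
    contractLeft f (tmul A m n) = f m • n := rfl

end contract

end NCTensor

/-- `M` is flat as a right `R`-module: `M ⊗_R -` preserves injections of left `R`-modules. -/
def IsRightFlat (R M : Type u) [Ring R] [AddCommGroup M] [Module Rᵐᵒᵖ M] : Prop :=
  ∀ (N N' : Type u) [AddCommGroup N] [AddCommGroup N'] [Module R N] [Module R N']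
    (f : N →ₗ[R] N'), Function.Injective f →
      Function.Injective (NCTensor.tensorMap (LinearMap.id : M →ₗ[Rᵐᵒᵖ] M) f)

/-! ## Corings -/

/-- `A`-corings: an `A`-bimodule `C` with an `A`-bilinear coassociative comultiplication
`Δ : C → C ⊗_A C` and an `A`-bilinear counit `ε : C → A`. -/
class Coring (A C : Type*) [Ring A] [AddCommGroup C] [Module A C] [Module Aᵐᵒᵖ C]
    [SMulCommClass A Aᵐᵒᵖ C] where
  /-- The comultiplication, as a left linear map. -/
  comul : C →ₗ[A] NCTensor A C C
  comul_op_smul : ∀ (a : A) (c : C), comul (op a • c) = op a • comul c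
  /-- The counit, as a left linear map. -/
  counit : C →ₗ[A] A
  counit_op_smul : ∀ (a : A) (c : C), counit (op a • c) = counit c * a
  coassoc : ∀ c : C,
    NCTensor.assoc (NCTensor.tensorMap
      ({ toFun := comul, map_add' := map_add comul,
         map_smul' := fun a c => comul_op_smul a.unop c } : C →ₗ[Aᵐᵒᵖ] NCTensor A C C)
      (LinearMap.id : C →ₗ[A] C) (comul c)) =
    NCTensor.tensorMap (LinearMap.id : C →ₗ[Aᵐᵒᵖ] C) comul (comul c)
  /-- `c₍₁₎ ε(c₍₂₎) = c` -/
  contractRight_counit : ∀ c : C, NCTensor.contractRight counit (comul c) = c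
  /-- `ε(c₍₁₎) c₍₂₎ = c` -/
  contractLeft_counit : ∀ c : C, NCTensor.contractLeft
      ({ toFun := counit, map_add' := map_add counit,
         map_smul' := fun a c => counit_op_smul a.unop c } : C →ₗ[Aᵐᵒᵖ] A) (comul c) = c

namespace Coring

open NCTensor

section leftDual

/-- The left dual `*C = _A Hom(C, A)`. -/
def LeftDual (A C : Type*) [Ring A] [AddCommGroup C] [Module A C] : Type _ := C →ₗ[A] A

variable {A C : Type*} [Ring A] [AddCommGroup C] [Module A C]

instance : AddCommGroup (LeftDual A C) := inferInstanceAs (AddCommGroup (C →ₗ[A] A))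

/-- The right `A`-module structure of `*C`: `(f a)(c) = f(c) a`. -/
instance : Module Aᵐᵒᵖ (LeftDual A C) := inferInstanceAs (Module Aᵐᵒᵖ (C →ₗ[A] A))

instance : FunLike (LeftDual A C) C A := inferInstanceAs (FunLike (C →ₗ[A] A) C A)

/-- An element of `*C` as a linear map. -/
def LeftDual.toLin (f : LeftDual A C) : C →ₗ[A] A := f

@[simp] theorem LeftDual.toLin_apply (f : LeftDual A C) (c : C) : f.toLin c = f c := rfl

@[ext] theorem LeftDual.ext {f g : LeftDual A C} (h : ∀ c : C, f c = g c) : f = g :=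
  LinearMap.ext h

@[simp] theorem LeftDual.map_smul (f : LeftDual A C) (a : A) (c : C) : f (a • c) = a * f c :=
  LinearMap.map_smul (f : C →ₗ[A] A) a c

@[simp] theorem LeftDual.map_add (f : LeftDual A C) (c d : C) : f (c + d) = f c + f d :=
  LinearMap.map_add (f : C →ₗ[A] A) c d

@[simp] theorem LeftDual.map_zero (f : LeftDual A C) : f (0 : C) = 0 :=
  LinearMap.map_zero (f : C →ₗ[A] A)

@[simp] theorem LeftDual.add_apply (f g : LeftDual A C) (c : C) : (f + g) c = f c + g c := rfl

@[simp] theorem LeftDual.zero_apply (c : C) : (0 : LeftDual A C) c = 0 := rfl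

@[simp] theorem LeftDual.op_smul_apply (a : A) (f : LeftDual A C) (c : C) :
    (op a • f) c = f c * a := rfl

end leftDual

section rightDual

/-- The right dual `C* = Hom_A(C, A)`. -/
def RightDual (A C : Type*) [Ring A] [AddCommGroup C] [Module Aᵐᵒᵖ C] : Type _ := C →ₗ[Aᵐᵒᵖ] A

variable {A C : Type*} [Ring A] [AddCommGroup C] [Module Aᵐᵒᵖ C]

instance : AddCommGroup (RightDual A C) := inferInstanceAs (AddCommGroup (C →ₗ[Aᵐᵒᵖ] A))

instance : FunLike (RightDual A C) C A := inferInstanceAs (FunLike (C →ₗ[Aᵐᵒᵖ] A) C A)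

/-- An element of `C*` as a linear map. -/
def RightDual.toLin (f : RightDual A C) : C →ₗ[Aᵐᵒᵖ] A := f

@[simp] theorem RightDual.toLin_apply (f : RightDual A C) (c : C) : f.toLin c = f c := rfl

@[ext] theorem RightDual.ext {f g : RightDual A C} (h : ∀ c : C, f c = g c) : f = g :=
  LinearMap.ext h

@[simp] theorem RightDual.map_op_smul (f : RightDual A C) (a : A) (c : C) :
    f (op a • c) = f c * a :=
  LinearMap.map_smul (f : C →ₗ[Aᵐᵒᵖ] A) (op a) c

@[simp] theorem RightDual.map_add (f : RightDual A C) (c d : C) : f (c + d) = f c + f d :=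
  LinearMap.map_add (f : C →ₗ[Aᵐᵒᵖ] A) c d

@[simp] theorem RightDual.map_zero (f : RightDual A C) : f (0 : C) = 0 :=
  LinearMap.map_zero (f : C →ₗ[Aᵐᵒᵖ] A)

@[simp] theorem RightDual.add_apply (f g : RightDual A C) (c : C) : (f + g) c = f c + g c := rfl

@[simp] theorem RightDual.zero_apply (c : C) : (0 : RightDual A C) c = 0 := rfl

end rightDual

section convolution

variable (A C : Type*) [Ring A] [AddCommGroup C] [Module A C] [Module Aᵐᵒᵖ C]
  [SMulCommClass A Aᵐᵒᵖ C] [Coring A C]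

/-- The comultiplication as a right linear map. -/
def comulR : C →ₗ[Aᵐᵒᵖ] NCTensor A C C where
  toFun := comul
  map_add' := map_add comul
  map_smul' a c := comul_op_smul a.unop c

/-- The counit as a right linear map. -/
def counitR : C →ₗ[Aᵐᵒᵖ] A where
  toFun := (counit : C →ₗ[A] A)
  map_add' := map_add counit
  map_smul' a c := counit_op_smul a.unop c

@[simp] theorem comulR_apply (c : C) : comulR A C c = comul (A := A) c := rfl

@[simp] theorem counitR_apply (c : C) : counitR A C c = counit (A := A) c := rfl

variable {A C}

/-- The right action of `*C` on `C`: `c · f = c₍₁₎ f(c₍₂₎)`. -/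
def actR (f : LeftDual A C) : C →ₗ[A] C where
  toFun c := NCTensor.contractRight f.toLin (comul (A := A) c)
  map_add' c d := by simp
  map_smul' a c := by
    rw [map_smul, RingHom.id_apply]
    exact hom_congr
      (f := (NCTensor.contractRight f.toLin).comp (DistribSMul.toAddMonoidHom (NCTensor A C C) a))
      (g := (DistribSMul.toAddMonoidHom C a).comp (NCTensor.contractRight f.toLin))
      (fun c d => by simp [smul_comm a]) _

/-- The left action of `C*` on `C`: `f · c = f(c₍₁₎) c₍₂₎`. -/
def actL (f : RightDual A C) : C →ₗ[Aᵐᵒᵖ] C where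
  toFun c := contractLeft f.toLin (comul (A := A) c)
  map_add' c d := by simp
  map_smul' a c := by
    obtain ⟨a, rfl⟩ := op_surjective a
    rw [comul_op_smul, RingHom.id_apply]
    exact hom_congr
      (f := (contractLeft f.toLin).comp (DistribSMul.toAddMonoidHom (NCTensor A C C) (op a)))
      (g := (DistribSMul.toAddMonoidHom C (op a)).comp (contractLeft f.toLin))
      (fun c d => by simp [smul_comm _ (op a)]) _

theorem actR_apply (f : LeftDual A C) (c : C) :
    actR f c = NCTensor.contractRight f.toLin (comul (A := A) c) := rfl

theorem actL_apply (f : RightDual A C) (c : C) :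
    actL f c = contractLeft f.toLin (comul (A := A) c) := rfl

/-- `Δ(c · f) = c₍₁₎ ⊗ c₍₂₎ · f` -/
theorem comul_actR (f : LeftDual A C) (c : C) :
    comul (A := A) (actR f c) = tensorMap LinearMap.id (actR f) (comul (A := A) c) := by
  let k : NCTensor A C C →ₗ[A] C :=
    { NCTensor.contractRight f.toLin with
      map_smul' := fun a => hom_congr
        (f := (NCTensor.contractRight f.toLin).comp (DistribSMul.toAddMonoidHom (NCTensor A C C) a))
        (g := (DistribSMul.toAddMonoidHom C a).comp (NCTensor.contractRight f.toLin))
        (fun c d => by simp [smul_comm a]) }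
  have h1 : ∀ (d : C) (s : NCTensor A C C),
      tensorMap (LinearMap.id : C →ₗ[Aᵐᵒᵖ] C) k (assoc (tmul A s d)) = op (f d) • s := fun d =>
    hom_congr (f := ((tensorMap (LinearMap.id : C →ₗ[Aᵐᵒᵖ] C) k).comp assoc).comp ((mkHom A).flip d))
      (g := DistribSMul.toAddMonoidHom (NCTensor A C C) (op (f d)))
      fun x y => by simp [k]
  have h2 : ∀ t : NCTensor A C C, comul (A := A) (NCTensor.contractRight f.toLin t) =
      tensorMap (LinearMap.id : C →ₗ[Aᵐᵒᵖ] C) k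
        (assoc (tensorMap (comulR A C) (LinearMap.id : C →ₗ[A] C) t)) :=
    hom_congr (f := (comul (A := A) (C := C)).toAddMonoidHom.comp (NCTensor.contractRight f.toLin))
      (g := ((tensorMap (LinearMap.id : C →ₗ[Aᵐᵒᵖ] C) k).comp assoc).comp
        (tensorMap (comulR A C) (LinearMap.id : C →ₗ[A] C)))
      fun x y => by simp [h1, comul_op_smul]
  rw [actR_apply, h2]
  exact (congrArg _ (coassoc (A := A) c)).trans (tensorMap_comp _ _ _ _ _)

/-- `Δ(f · c) = f · c₍₁₎ ⊗ c₍₂₎` -/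
theorem comul_actL (f : RightDual A C) (c : C) :
    comul (A := A) (actL f c) = tensorMap (actL f) LinearMap.id (comul (A := A) c) := by
  have h1 : ∀ (x : C) (t : NCTensor A C C), f x • t =
      contractLeft f.toLin (tmul A x t) := fun x t => rfl
  have h2 : ∀ t : NCTensor A C C, comul (A := A) (contractLeft f.toLin t) =
      contractLeft f.toLin (tensorMap (LinearMap.id : C →ₗ[Aᵐᵒᵖ] C) (comul (A := A)) t) :=
    hom_congr (f := (comul (A := A) (C := C)).toAddMonoidHom.comp (contractLeft f.toLin))
      (g := (contractLeft f.toLin).comp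
        (tensorMap (LinearMap.id : C →ₗ[Aᵐᵒᵖ] C) (comul (A := A))))
      fun x y => by simp
  have h3 : ∀ (d : C) (s : NCTensor A C C), contractLeft f.toLin (assoc (tmul A s d)) =
      tmul A (contractLeft f.toLin s) d := fun d =>
    hom_congr (f := ((contractLeft f.toLin).comp assoc).comp ((mkHom A).flip d))
      (g := ((mkHom A).flip d).comp (contractLeft f.toLin)) fun x y => by simp
  have h4 : ∀ t : NCTensor A C C,
      contractLeft f.toLin (assoc (tensorMap (comulR A C) (LinearMap.id : C →ₗ[A] C) t)) =
      tensorMap (actL f) (LinearMap.id : C →ₗ[A] C) t :=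
    hom_congr (f := ((contractLeft f.toLin).comp assoc).comp
        (tensorMap (comulR A C) (LinearMap.id : C →ₗ[A] C)))
      (g := tensorMap (actL f) (LinearMap.id : C →ₗ[A] C)) fun x y => by simp [h3, actL_apply]
  rw [← h4, actL_apply, h2]
  exact congrArg _ (coassoc (A := A) c).symm

instance : Mul (LeftDual A C) := ⟨fun f g => g.toLin ∘ₗ actR f⟩

instance : One (LeftDual A C) := ⟨(counit : C →ₗ[A] A)⟩

instance : Mul (RightDual A C) := ⟨fun f g => f.toLin ∘ₗ actL g⟩

instance : One (RightDual A C) := ⟨counitR A C⟩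

/-- `(f * g)(c) = g(c₍₁₎ f(c₍₂₎))` -/
theorem LeftDual.mul_apply (f g : LeftDual A C) (c : C) : (f * g) c = g (actR f c) := rfl

/-- `(f * g)(c) = f(g(c₍₁₎) c₍₂₎)` -/
theorem RightDual.mul_apply (f g : RightDual A C) (c : C) : (f * g) c = f (actL g c) := rfl

theorem LeftDual.one_apply (c : C) : (1 : LeftDual A C) c = counit (A := A) c := rfl

theorem RightDual.one_apply (c : C) : (1 : RightDual A C) c = counit (A := A) c := rfl

theorem actR_one (c : C) : actR (1 : LeftDual A C) c = c := contractRight_counit c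

theorem actL_one (c : C) : actL (1 : RightDual A C) c = c := contractLeft_counit c

theorem actR_mul (f g : LeftDual A C) (c : C) : actR (f * g) c = actR g (actR f c) := by
  rw [actR_apply g, comul_actR, actR_apply]
  exact hom_congr (f := NCTensor.contractRight (f * g).toLin)
    (g := (NCTensor.contractRight g.toLin).comp (tensorMap LinearMap.id (actR f)))
    (fun x y => by simp [LeftDual.mul_apply]) _

theorem actL_mul (f g : RightDual A C) (c : C) : actL (f * g) c = actL f (actL g c) := by
  rw [actL_apply f, comul_actL, actL_apply]
  exact hom_congr (f := contractLeft (f * g).toLin)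
    (g := (contractLeft f.toLin).comp (tensorMap (actL g) LinearMap.id))
    (fun x y => by simp [RightDual.mul_apply]) _

theorem actR_add (f g : LeftDual A C) (c : C) : actR (f + g) c = actR f c + actR g c :=
  hom_congr (f := (NCTensor.contractRight (f + g).toLin : NCTensor A C C →+ C))
    (g := NCTensor.contractRight f.toLin + NCTensor.contractRight g.toLin)
    (fun x y => by simp [add_smul]) _

theorem actL_add (f g : RightDual A C) (c : C) : actL (f + g) c = actL f c + actL g c :=
  hom_congr (f := (contractLeft (f + g).toLin : NCTensor A C C →+ C))
    (g := contractLeft f.toLin + contractLeft g.toLin)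
    (fun x y => by simp [add_smul]) _

theorem actR_zero (c : C) : actR (0 : LeftDual A C) c = 0 :=
  hom_congr (f := NCTensor.contractRight (0 : LeftDual A C).toLin) (g := 0) (fun x y => by simp) _

theorem actL_zero (c : C) : actL (0 : RightDual A C) c = 0 :=
  hom_congr (f := contractLeft (0 : RightDual A C).toLin) (g := 0) (fun x y => by simp) _

theorem counit_actR (f : LeftDual A C) (c : C) : counit (A := A) (actR f c) = f c := by
  conv_rhs => rw [← contractLeft_counit (A := A) c]
  exact hom_congr (f := (counit (A := A) (C := C)).toAddMonoidHom.comp (NCTensor.contractRight f.toLin))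
    (g := f.toLin.toAddMonoidHom.comp (contractLeft (counitR A C)))
    (fun x y => by simp [counit_op_smul]) _

theorem counit_actL (f : RightDual A C) (c : C) : counit (A := A) (actL f c) = f c := by
  conv_rhs => rw [← contractRight_counit (A := A) c]
  exact hom_congr (f := (counit (A := A) (C := C)).toAddMonoidHom.comp (contractLeft f.toLin))
    (g := f.toLin.toAddMonoidHom.comp (NCTensor.contractRight counit))
    (fun x y => by simp) _

/-- The ring `*C`, with unit `ε` and `(f * g)(c) = g(c₍₁₎ f(c₍₂₎))`. -/
instance : Ring (LeftDual A C) where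
  __ := (inferInstance : AddCommGroup (LeftDual A C))
  mul_assoc f g h := by ext c; simp [LeftDual.mul_apply, actR_mul]
  one_mul f := by ext c; simp [LeftDual.mul_apply, actR_one]
  mul_one f := by ext c; rw [LeftDual.mul_apply, LeftDual.one_apply, counit_actR]
  left_distrib f g h := by ext c; simp [LeftDual.mul_apply]
  right_distrib f g h := by ext c; simp [LeftDual.mul_apply, actR_add]
  zero_mul f := by ext c; simp [LeftDual.mul_apply, actR_zero]
  mul_zero f := by ext c; simp [LeftDual.mul_apply]

/-- The ring `C*`, with unit `ε` and `(f * g)(c) = f(g(c₍₁₎) c₍₂₎)`. -/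
instance : Ring (RightDual A C) where
  __ := (inferInstance : AddCommGroup (RightDual A C))
  mul_assoc f g h := by ext c; simp [RightDual.mul_apply, actL_mul]
  one_mul f := by ext c; rw [RightDual.mul_apply, RightDual.one_apply, counit_actL]
  mul_one f := by ext c; simp [RightDual.mul_apply, actL_one]
  left_distrib f g h := by ext c; simp [RightDual.mul_apply, actL_add]
  right_distrib f g h := by ext c; simp [RightDual.mul_apply]
  zero_mul f := by ext c; simp [RightDual.mul_apply]
  mul_zero f := by ext c; simp [RightDual.mul_apply, actL_zero]

/-- `C` as a right `*C`-module: `c · f = c₍₁₎ f(c₍₂₎)`. -/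
instance : Module (LeftDual A C)ᵐᵒᵖ C where
  smul f c := actR f.unop c
  one_smul c := actR_one c
  mul_smul f g c := actR_mul g.unop f.unop c
  smul_zero f := map_zero (actR f.unop)
  smul_add f := map_add (actR f.unop)
  add_smul f g c := actR_add f.unop g.unop c
  zero_smul c := actR_zero c

/-- `C` as a left `C*`-module: `f · c = f(c₍₁₎) c₍₂₎`. -/
instance : Module (RightDual A C) C where
  smul f c := actL f c
  one_smul c := actL_one c
  mul_smul f g c := actL_mul f g c
  smul_zero f := map_zero (actL f)
  smul_add f := map_add (actL f)
  add_smul f g c := actL_add f g c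
  zero_smul c := actL_zero c

instance : SMulCommClass (RightDual A C) Aᵐᵒᵖ C :=
  ⟨fun f a c => (actL f).map_smul a c⟩

@[simp] theorem op_smul_eq (f : LeftDual A C) (c : C) : op f • c = actR f c := rfl

@[simp] theorem smul_eq (f : RightDual A C) (c : C) : f • c = actL f c := rfl

end convolution

/-! ## Comodules -/

section comodules

variable (A C : Type u) [Ring A] [AddCommGroup C] [Module A C] [Module Aᵐᵒᵖ C]
  [SMulCommClass A Aᵐᵒᵖ C] [Coring A C]

/-- Right `C`-comodules: right `A`-modules `M` with a right `A`-linear, coassociative and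
counital coaction `M → M ⊗_A C`. -/
structure RightComodule where
  carrier : Type u
  [addCommGroup : AddCommGroup carrier]
  [module : Module Aᵐᵒᵖ carrier]
  coact : carrier →ₗ[Aᵐᵒᵖ] NCTensor A carrier C
  coassoc : ∀ m : carrier,
    assoc (tensorMap coact (LinearMap.id : C →ₗ[A] C) (coact m)) =
      tensorMap (LinearMap.id : carrier →ₗ[Aᵐᵒᵖ] carrier) (comul (A := A)) (coact m)
  counital : ∀ m : carrier, NCTensor.contractRight (counit (A := A)) (coact m) = m

/-- Left `C`-comodules: left `A`-modules `N` with a left `A`-linear, coassociative and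
counital coaction `N → C ⊗_A N`. -/
structure LeftComodule where
  carrier : Type u
  [addCommGroup : AddCommGroup carrier]
  [module : Module A carrier]
  coact : carrier →ₗ[A] NCTensor A C carrier
  coassoc : ∀ n : carrier,
    assoc (tensorMap (comulR A C) (LinearMap.id : carrier →ₗ[A] carrier) (coact n)) =
      tensorMap (LinearMap.id : C →ₗ[Aᵐᵒᵖ] C) coact (coact n)
  counital : ∀ n : carrier, contractLeft (counitR A C) (coact n) = n

attribute [instance] RightComodule.addCommGroup RightComodule.module
  LeftComodule.addCommGroup LeftComodule.module

variable {A C}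

/-- The group `Hom^C(M, N)` of right `A`-linear maps that commute with the coactions. -/
def RightComodule.colin (M N : RightComodule A C) :
    AddSubgroup (M.carrier →ₗ[Aᵐᵒᵖ] N.carrier) where
  carrier := {f | ∀ m, N.coact (f m) = tensorMap f (LinearMap.id : C →ₗ[A] C) (M.coact m)}
  add_mem' hf hg m := by simp [tensorMap_add_left, hf m, hg m]
  zero_mem' m := by
    simpa using (hom_congr (f := tensorMap (0 : M.carrier →ₗ[Aᵐᵒᵖ] N.carrier)
      (LinearMap.id : C →ₗ[A] C)) (g := 0) (fun m n => by simp [zero_tmul]) (M.coact m)).symm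
  neg_mem' hf m := by simp [tensorMap_neg_left, hf m]

/-- The group `^C Hom(M, N)` of left `A`-linear maps that commute with the coactions. -/
def LeftComodule.colin (M N : LeftComodule A C) :
    AddSubgroup (M.carrier →ₗ[A] N.carrier) where
  carrier := {f | ∀ m, N.coact (f m) = tensorMap (LinearMap.id : C →ₗ[Aᵐᵒᵖ] C) f (M.coact m)}
  add_mem' hf hg m := by simp [tensorMap_add_right, hf m, hg m]
  zero_mem' m := by
    simpa using (hom_congr (f := tensorMap (LinearMap.id : C →ₗ[Aᵐᵒᵖ] C)
      (0 : M.carrier →ₗ[A] N.carrier)) (g := 0) (fun m n => by simp [tmul_zero])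
      (M.coact m)).symm
  neg_mem' hf m := by simp [tensorMap_neg_right, hf m]

/-- The category `M^C` of right `C`-comodules. -/
instance : Category.{u} (RightComodule A C) where
  Hom M N := M.colin N
  id M := ⟨LinearMap.id, fun m => (tensorMap_id _).symm⟩
  comp f g := ⟨g.1 ∘ₗ f.1, fun m => by
    rw [LinearMap.comp_apply, g.2, f.2, tensorMap_comp, LinearMap.comp_id]⟩

/-- The category `^C M` of left `C`-comodules. -/
instance : Category.{u} (LeftComodule A C) where
  Hom M N := M.colin N
  id M := ⟨LinearMap.id, fun m => (tensorMap_id _).symm⟩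
  comp f g := ⟨g.1 ∘ₗ f.1, fun m => by
    rw [LinearMap.comp_apply, g.2, f.2, tensorMap_comp, LinearMap.comp_id]⟩

variable (A C)

/-- `C` as a right comodule over itself. -/
abbrev RightComodule.self : RightComodule A C where
  carrier := C
  coact := comulR A C
  coassoc := Coring.coassoc
  counital := contractRight_counit

/-- `C` as a left comodule over itself. -/
abbrev LeftComodule.self : LeftComodule A C where
  carrier := C
  coact := comul
  coassoc := Coring.coassoc
  counital := contractLeft_counit

end comodules

/-! ## The functor `- ⊗_{C*} C` -/

section induction

variable {A C : Type u} [Ring A] [AddCommGroup C] [Module A C] [Module Aᵐᵒᵖ C]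
  [SMulCommClass A Aᵐᵒᵖ C] [Coring A C]

variable {M : Type u} [AddCommGroup M] [Module (RightDual A C)ᵐᵒᵖ M]

/-- The right `A`-linear map `C → M ⊗_{C*} C`, `c ↦ m ⊗ c`. -/
def constTmul (m : M) : C →ₗ[Aᵐᵒᵖ] NCTensor (RightDual A C) M C where
  toFun c := tmul (RightDual A C) m c
  map_add' c d := tmul_add _ m c d
  map_smul' _ _ := rfl

@[simp] theorem constTmul_apply (m : M) (c : C) :
    (constTmul m : C →ₗ[Aᵐᵒᵖ] NCTensor (RightDual A C) M C) c = tmul (RightDual A C) m c := rfl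

variable (A C M)

/-- The coaction `M ⊗_{C*} C → (M ⊗_{C*} C) ⊗_A C`, `m ⊗ c ↦ (m ⊗ c₍₁₎) ⊗ c₍₂₎`. -/
def inducedCoact : NCTensor (RightDual A C) M C →ₗ[Aᵐᵒᵖ]
    NCTensor A (NCTensor (RightDual A C) M C) C :=
  let F : NCTensor (RightDual A C) M C →+ NCTensor A (NCTensor (RightDual A C) M C) C :=
    lift
      (AddMonoidHom.mk' (fun m => (tensorMap (constTmul m) (LinearMap.id : C →ₗ[A] C)).comp
          (comul (A := A) (C := C)).toAddMonoidHom) fun m m' => by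
        ext c
        simp only [AddMonoidHom.comp_apply, AddMonoidHom.add_apply]
        rw [← tensorMap_add_left]
        congr 2
        ext d
        exact add_tmul _ m m' d)
      fun f m c => by
        simp only [AddMonoidHom.mk'_apply, AddMonoidHom.comp_apply, smul_eq,
          LinearMap.toAddMonoidHom_coe, comul_actL, tensorMap_comp]
        congr 2
        ext d
        exact smul_tmul _ f m d
  { F with
    map_smul' := fun a => by
      obtain ⟨a, rfl⟩ := op_surjective a
      refine hom_congr (f := F.comp (DistribSMul.toAddMonoidHom _ (op a)))
        (g := (DistribSMul.toAddMonoidHom _ (op a)).comp F) fun m c => ?_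
      simp only [F, AddMonoidHom.comp_apply, DistribSMul.toAddMonoidHom_apply, right_smul_tmul,
        lift_tmul, AddMonoidHom.mk'_apply, LinearMap.toAddMonoidHom_coe, comul_op_smul]
      exact hom_congr (f := (tensorMap (constTmul m) (LinearMap.id : C →ₗ[A] C)).comp
          (DistribSMul.toAddMonoidHom (NCTensor A C C) (op a)))
        (g := (DistribSMul.toAddMonoidHom _ (op a)).comp
          (tensorMap (constTmul m) (LinearMap.id : C →ₗ[A] C))) (fun x y => by simp) _ }

theorem inducedCoact_tmul (m : M) (c : C) :
    inducedCoact A C M (tmul (RightDual A C) m c) =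
      tensorMap (constTmul m) (LinearMap.id : C →ₗ[A] C) (comul (A := A) c) := rfl

/-- The right comodule `M ⊗_{C*} C`. -/
def inducedObj : RightComodule A C where
  carrier := NCTensor (RightDual A C) M C
  coact := inducedCoact A C M
  coassoc := by
    have h1 : ∀ (m : M) (d : C) (s : NCTensor A C C),
        assoc (tmul A (tensorMap (constTmul m) (LinearMap.id : C →ₗ[A] C) s) d) =
        tensorMap (constTmul m) (LinearMap.id : NCTensor A C C →ₗ[A] NCTensor A C C)
          (assoc (tmul A s d)) := fun m d =>
      hom_congr (f := (assoc.comp ((mkHom A).flip d)).comp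
          (tensorMap (constTmul m) (LinearMap.id : C →ₗ[A] C)))
        (g := ((tensorMap (constTmul m) (LinearMap.id : NCTensor A C C →ₗ[A] NCTensor A C C)).comp
          assoc).comp ((mkHom A).flip d)) fun x y => by simp
    have h2 : ∀ (m : M) (t : NCTensor A C C),
        assoc (tensorMap (inducedCoact A C M) (LinearMap.id : C →ₗ[A] C)
          (tensorMap (constTmul m) (LinearMap.id : C →ₗ[A] C) t)) =
        tensorMap (constTmul m) (LinearMap.id : NCTensor A C C →ₗ[A] NCTensor A C C)
          (assoc (tensorMap (comulR A C) (LinearMap.id : C →ₗ[A] C) t)) := fun m =>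
      hom_congr (f := (assoc.comp (tensorMap (inducedCoact A C M) (LinearMap.id : C →ₗ[A] C))).comp
          (tensorMap (constTmul m) (LinearMap.id : C →ₗ[A] C)))
        (g := ((tensorMap (constTmul m) (LinearMap.id : NCTensor A C C →ₗ[A] NCTensor A C C)).comp
          assoc).comp (tensorMap (comulR A C) (LinearMap.id : C →ₗ[A] C)))
        fun x y => by simp [inducedCoact_tmul, h1]
    refine hom_congr
      (f := (assoc.comp (tensorMap (inducedCoact A C M) (LinearMap.id : C →ₗ[A] C))).comp
        (inducedCoact A C M).toAddMonoidHom)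
      (g := (tensorMap LinearMap.id (comul (A := A))).comp (inducedCoact A C M).toAddMonoidHom)
      fun m c => ?_
    simp only [AddMonoidHom.comp_apply, LinearMap.toAddMonoidHom_coe, inducedCoact_tmul, h2]
    refine (congrArg _ (Coring.coassoc (A := A) c)).trans ?_
    rw [tensorMap_comp, tensorMap_comp]
    rfl
  counital := by
    refine hom_congr (f := (NCTensor.contractRight (counit (A := A))).comp
        (inducedCoact A C M).toAddMonoidHom) (g := AddMonoidHom.id _) fun m c => ?_
    simp only [AddMonoidHom.comp_apply, LinearMap.toAddMonoidHom_coe, inducedCoact_tmul,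
      AddMonoidHom.id_apply]
    conv_rhs => rw [← contractRight_counit (A := A) c]
    exact hom_congr (f := (NCTensor.contractRight (counit (A := A))).comp
        (tensorMap (constTmul m) (LinearMap.id : C →ₗ[A] C)))
      (g := ((mkHom (RightDual A C) m)).comp (NCTensor.contractRight (counit (A := A) (C := C))))
      (fun x y => by simp) _

variable {M}
variable {M' : Type u} [AddCommGroup M'] [Module (RightDual A C)ᵐᵒᵖ M']

/-- The right `A`-linear map `g ⊗_{C*} C`. -/
def inducedLin (g : M →ₗ[(RightDual A C)ᵐᵒᵖ] M') :
    NCTensor (RightDual A C) M C →ₗ[Aᵐᵒᵖ] NCTensor (RightDual A C) M' C :=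
  { tensorMap g (LinearMap.id : C →ₗ[RightDual A C] C) with
    map_smul' := fun a => by
      obtain ⟨a, rfl⟩ := op_surjective a
      exact hom_congr (f := (tensorMap g (LinearMap.id : C →ₗ[RightDual A C] C)).comp
          (DistribSMul.toAddMonoidHom (NCTensor (RightDual A C) M C) (op a)))
        (g := (DistribSMul.toAddMonoidHom (NCTensor (RightDual A C) M' C) (op a)).comp
          (tensorMap g (LinearMap.id : C →ₗ[RightDual A C] C))) (fun m c => by simp) }

/-- The colinear map `g ⊗_{C*} C`. -/
def inducedMap (g : M →ₗ[(RightDual A C)ᵐᵒᵖ] M') : inducedObj A C M ⟶ inducedObj A C M' :=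
  ⟨inducedLin A C g, hom_congr
    (f := (inducedCoact A C M').toAddMonoidHom.comp (inducedLin A C g).toAddMonoidHom)
    (g := (tensorMap (inducedLin A C g) (LinearMap.id : C →ₗ[A] C)).comp
      (inducedCoact A C M).toAddMonoidHom)
    fun m c => (tensorMap_comp (constTmul m) (inducedLin A C g) (LinearMap.id : C →ₗ[A] C)
      LinearMap.id (comul (A := A) c)).symm⟩

/-- The functor `- ⊗_{C*} C` from right `C*`-modules to right `C`-comodules. -/
def inducedFunctor : ModuleCat.{u} (RightDual A C)ᵐᵒᵖ ⥤ RightComodule A C where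
  obj M := inducedObj A C M
  map g := inducedMap A C g.hom
  map_id M := Subtype.ext (LinearMap.ext
    (NCTensor.tensorMap_id (R := RightDual A C) (M := M) (N := C)))
  map_comp f g := Subtype.ext (LinearMap.ext fun _ =>
    (NCTensor.tensorMap_comp f.hom g.hom (LinearMap.id : C →ₗ[RightDual A C] C)
      LinearMap.id _).symm)

end induction

/-! ## The functor `^C Hom(C, -)` -/

section homFunctor

variable (A C : Type u) [Ring A] [AddCommGroup C] [Module A C] [Module Aᵐᵒᵖ C]
  [SMulCommClass A Aᵐᵒᵖ C] [Coring A C]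

variable {A C} in
/-- The endomorphism `c ↦ c · f` of the left comodule `C`, for `f` in `*C`. -/
def actRHom (f : LeftDual A C) : LeftComodule.self A C ⟶ LeftComodule.self A C :=
  ⟨show C →ₗ[A] C from actR f, fun c => comul_actR f (show C from c)⟩

/-- The left `*C`-module structure of `^C Hom(C, N)`: `(f φ)(c) = φ(c · f)`. -/
instance (N : LeftComodule A C) : Module (LeftDual A C) ((LeftComodule.self A C).colin N) where
  smul f φ := actRHom f ≫ (show LeftComodule.self A C ⟶ N from φ)
  one_smul φ := Subtype.ext (LinearMap.ext fun c => congrArg φ.1 (actR_one c))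
  mul_smul f g φ := Subtype.ext (LinearMap.ext fun c => congrArg φ.1 (actR_mul f g c))
  smul_zero _ := rfl
  smul_add _ _ _ := rfl
  add_smul f g φ := Subtype.ext (LinearMap.ext fun c =>
    (congrArg φ.1 (actR_add f g c)).trans (_root_.map_add φ.1 _ _))
  zero_smul φ := Subtype.ext (LinearMap.ext fun c =>
    (congrArg φ.1 (actR_zero c)).trans (_root_.map_zero φ.1))

/-- The functor `^C Hom(C, -)` from left `C`-comodules to left `*C`-modules. -/
def leftHomFunctor : LeftComodule A C ⥤ ModuleCat.{u} (LeftDual A C) where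
  obj N := ModuleCat.of (LeftDual A C) ((LeftComodule.self A C).colin N)
  map g := ModuleCat.ofHom
    { toFun := fun φ => (show LeftComodule.self A C ⟶ _ from φ) ≫ g
      map_add' := fun _ _ => Subtype.ext (LinearMap.ext fun _ => _root_.map_add g.1 _ _)
      map_smul' := fun _ _ => rfl }
  map_id _ := rfl
  map_comp _ _ := rfl

end homFunctor

/-! ## The map of the Morita context of `C` -/

section morita

variable (A C : Type u) [Ring A] [AddCommGroup C] [Module A C] [Module Aᵐᵒᵖ C]
  [SMulCommClass A Aᵐᵒᵖ C] [Coring A C]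

variable {A C} in
/-- For right `A`-linear `q : C → *C`, the right `A`-linear form `x ↦ q(x)(c)`. -/
def evalAt (q : C →ₗ[Aᵐᵒᵖ] LeftDual A C) (c : C) : RightDual A C :=
  ({ toFun := fun x => q x c
     map_add' := fun x y => by simp
     map_smul' := fun a x => by
      obtain ⟨a, rfl⟩ := op_surjective a
      simp } : C →ₗ[Aᵐᵒᵖ] A)

/-- The group `Q` of all right `A`-linear maps `q : C → *C` such that
`q(x₍₁₎)(c) x₍₂₎ = c₍₁₎ q(x)(c₍₂₎)` for all `x` and `c` in `C`. -/
def moritaQ : AddSubgroup (C →ₗ[Aᵐᵒᵖ] LeftDual A C) where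
  carrier := {q | ∀ x c : C, actL (evalAt q c) x = actR (q x) c}
  add_mem' {p q} hp hq x c := by
    rw [LinearMap.add_apply, actR_add, ← hp, ← hq, ← actL_add]; rfl
  zero_mem' x c := by
    rw [LinearMap.zero_apply, actR_zero, ← actL_zero (A := A) x]; rfl
  neg_mem' {q} hq x c := by
    have h1 : actR (-(q x)) c = -actR (q x) c := by
      rw [eq_neg_iff_add_eq_zero, ← actR_add, neg_add_cancel, actR_zero]
    have h2 : actL (-(evalAt q c)) x = -actL (evalAt q c) x := by
      rw [eq_neg_iff_add_eq_zero, ← actL_add, neg_add_cancel, actL_zero]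
    rw [LinearMap.neg_apply, h1, ← hq, ← h2]; rfl

/-- The left `*C`-module structure of `Q`: `(f q)(x) = f * q(x)`. -/
instance : Module (LeftDual A C) (moritaQ A C) where
  smul f q := ⟨{ toFun := fun x => f * q.1 x
                 map_add' := fun x y => by rw [_root_.map_add, mul_add]
                 map_smul' := fun a x => by rw [_root_.map_smul]; rfl }, fun x c => by
    refine Eq.trans ?_ (actR_mul f (q.1 x) c).symm
    exact q.2 x (actR f c)⟩
  one_smul q := Subtype.ext (LinearMap.ext fun x => one_mul (q.1 x))
  mul_smul f g q := Subtype.ext (LinearMap.ext fun x => mul_assoc f g (q.1 x))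
  smul_zero f := Subtype.ext (LinearMap.ext fun x => mul_zero f)
  smul_add f p q := Subtype.ext (LinearMap.ext fun x => mul_add f (p.1 x) (q.1 x))
  add_smul f g q := Subtype.ext (LinearMap.ext fun x => add_mul f g (q.1 x))
  zero_smul q := Subtype.ext (LinearMap.ext fun x => zero_mul (q.1 x))

variable {A C} in
/-- The endomorphism `y ↦ x · q(y) = x₍₁₎ q(y)(x₍₂₎)` of the right comodule `C`. -/
def triangleAt (x : C) (q : moritaQ A C) :
    (RightComodule.self A C).colin (RightComodule.self A C) :=
  ⟨({ toFun := fun y => actR (q.1 y) x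
      map_add' := fun y z => by rw [_root_.map_add, actR_add]
      map_smul' := fun a y => by
        rw [← q.2, ← q.2, _root_.map_smul]; rfl } : C →ₗ[Aᵐᵒᵖ] C), fun y => by
    refine (congrArg (comul (A := A)) (q.2 y x).symm).trans ((comul_actL _ (show C from y)).trans ?_)
    congr 2
    exact LinearMap.ext fun z => q.2 z x⟩

/-- The map `C ⊗_{*C} Q → End^C(C)`, `x ⊗ q ↦ (y ↦ x · q(y))`, of the Morita context of the right
comodule `C`. -/
def triangle : NCTensor (LeftDual A C) C (moritaQ A C) →+
    (RightComodule.self A C).colin (RightComodule.self A C) :=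
  lift
    (AddMonoidHom.mk'
      (fun x => AddMonoidHom.mk' (triangleAt x) fun p q =>
        Subtype.ext (LinearMap.ext fun y => actR_add (p.1 y) (q.1 y) x))
      fun x x' => by
        ext q y
        exact _root_.map_add (actR (q.1 y)) x x')
    fun f x q => Subtype.ext (LinearMap.ext fun y => (actR_mul f (q.1 y) x).symm)

end morita

/-- `C` is a direct summand of a finite number of copies of `*C` as a right `*C`-module. -/
def IsLeftQuasiFrobenius (A C : Type*) [Ring A] [AddCommGroup C] [Module A C] [Module Aᵐᵒᵖ C]
    [SMulCommClass A Aᵐᵒᵖ C] [Coring A C] : Prop :=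
  ∃ (n : ℕ) (i : C →ₗ[(LeftDual A C)ᵐᵒᵖ] (Fin n → LeftDual A C))
    (p : (Fin n → LeftDual A C) →ₗ[(LeftDual A C)ᵐᵒᵖ] C), p ∘ₗ i = LinearMap.id

end Coring

/-! Everything passes through one finite datum, a `MoritaBasis`: elements cᵢ of C and qᵢ of Q with x
= ∑ cᵢ · qᵢ(x) for all x. Its strength comes from reading Q in two ways. The defining identity of Q
makes every q right *C-linear as a map C → *C, and makes c ↦ q(-)(c) left C*-linear as a map C → C*.
If C is finitely generated projective over A on the left, all *C-linear maps C → *C arise so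
(`exists_toLeftDual_eq`); if it is so on the right, all C*-linear maps C → C* do
(`exists_toRightDual_eq`). A Morita basis is thus a finite dual basis of C over *C, which is
statement 1, and it also says that 1 = ∑ qᵢ(-)(cᵢ) lies in the trace ideal of C in C*, so that C
generates the left C*-modules.

From a basis the other statements follow by explicit formulas: expanding qᵢ(x) in a left dual basis
gives a right dual basis over A; φ = ▽(∑ φ(cᵢ) ⊗ qᵢ); n = ∑ qᵢ(n₍₋₁₎)(cᵢ) n₍₀₎ in every left
comodule; and contraction with the qᵢ reconstructs morphisms from their images under the two
functors and elements of C ⊗ N from N.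

Conversely, a preimage of the identity under ▽ is a basis. If - ⊗_{C*} C is faithful, a tuple d of
generators of C over A gives a pure monomorphism C* → Cᵐ, r ↦ r d; since Cᵐ is finitely presented
over C*, this splits (`exists_linearMap_apply_eq_one`), and the splitting puts 1 in the trace ideal.
If C is a generator, left C*-modules are viewed as left comodules and C* → C*/(trace ideal) is
compared with zero. If C is flat over *C, it is finitely presented over *C as well, hence projective
(`IsRightFlat.projective`). -/

namespace NCTensor

variable {A M N N' M' : Type*} [Ring A] [AddCommGroup M] [AddCommGroup N] [AddCommGroup N']
  [AddCommGroup M'] [Module Aᵐᵒᵖ M] [Module Aᵐᵒᵖ M'] [Module A N] [Module A N']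

/-- Naturality of contraction. Applied to a colinearity identity, it turns colinear maps into maps
linear over a dual ring. -/
theorem contractRight_tensorMap (f : N' →ₗ[A] A) (g : M →ₗ[Aᵐᵒᵖ] M') (h : N →ₗ[A] N')
    (t : NCTensor A M N) :
    NCTensor.contractRight f (tensorMap g h t) = g (NCTensor.contractRight (f ∘ₗ h) t) :=
  hom_congr (f := (NCTensor.contractRight f).comp (tensorMap g h))
    (g := g.toAddMonoidHom.comp (NCTensor.contractRight (f ∘ₗ h)))
    (fun x y => by simp) t

theorem contractLeft_tensorMap (f : M' →ₗ[Aᵐᵒᵖ] A) (g : M →ₗ[Aᵐᵒᵖ] M') (h : N →ₗ[A] N')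
    (t : NCTensor A M N) :
    contractLeft f (tensorMap g h t) = h (contractLeft (f ∘ₗ g) t) :=
  hom_congr (f := (contractLeft f).comp (tensorMap g h))
    (g := h.toAddMonoidHom.comp (contractLeft (f ∘ₗ g)))
    (fun x y => by simp) t

end NCTensor

namespace Coring

open NCTensor

/-! ### Dual bases of C over A, on either side. -/

section dualBasis

variable {A C : Type*} [Ring A] [AddCommGroup C]

theorem exists_leftDualBasis [Module A C] [Module.Finite A C] [Module.Projective A C] :
    ∃ (n : ℕ) (e : Fin n → C) (f : Fin n → LeftDual A C), ∀ x, ∑ i, f i x • e i = x := by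
  obtain ⟨n, p, s, -, -, hps⟩ := Module.Finite.exists_comp_eq_id_of_projective A C
  refine ⟨n, fun i => p (Pi.single i 1), fun i => LinearMap.proj i ∘ₗ s, fun x => ?_⟩
  have h := LinearMap.congr_fun hps x
  rw [LinearMap.comp_apply, pi_eq_sum_univ' (s x), _root_.map_sum] at h
  simp only [_root_.map_smul] at h
  exact h

theorem exists_rightDualBasis [Module Aᵐᵒᵖ C] [Module.Finite Aᵐᵒᵖ C]
    [Module.Projective Aᵐᵒᵖ C] :
    ∃ (n : ℕ) (e : Fin n → C) (f : Fin n → RightDual A C), ∀ x, ∑ i, op (f i x) • e i = x := by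
  obtain ⟨n, p, s, -, -, hps⟩ := Module.Finite.exists_comp_eq_id_of_projective Aᵐᵒᵖ C
  refine ⟨n, fun i => p (Pi.single i 1), fun i =>
    ({ toFun := fun x => unop (s x i)
       map_add' := fun x y => by simp
       map_smul' := fun a x => by simp } : C →ₗ[Aᵐᵒᵖ] A), fun x => ?_⟩
  have h := LinearMap.congr_fun hps x
  rw [LinearMap.comp_apply, pi_eq_sum_univ' (s x), _root_.map_sum] at h
  simp only [_root_.map_smul] at h
  exact h

theorem LeftDual.sum_apply [Module A C] {ι : Type*} (s : Finset ι) (f : ι → LeftDual A C) (c : C) :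
    (∑ i ∈ s, f i) c = ∑ i ∈ s, f i c :=
  LinearMap.sum_apply s f c

theorem RightDual.sum_apply [Module Aᵐᵒᵖ C] {ι : Type*} (s : Finset ι) (f : ι → RightDual A C)
    (c : C) : (∑ i ∈ s, f i) c = ∑ i ∈ s, f i c :=
  LinearMap.sum_apply s f c

theorem LeftDual.map_sum [Module A C] {ι : Type*} (s : Finset ι) (f : LeftDual A C) (c : ι → C) :
    f (∑ i ∈ s, c i) = ∑ i ∈ s, f (c i) :=
  _root_.map_sum f.toLin c s

theorem RightDual.map_sum [Module Aᵐᵒᵖ C] {ι : Type*} (s : Finset ι) (f : RightDual A C)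
    (c : ι → C) : f (∑ i ∈ s, c i) = ∑ i ∈ s, f (c i) :=
  _root_.map_sum f.toLin c s

theorem eq_of_forall_leftDual [Module A C] [Module.Finite A C] [Module.Projective A C] {x y : C}
    (h : ∀ f : LeftDual A C, f x = f y) : x = y := by
  obtain ⟨n, e, f, hf⟩ := exists_leftDualBasis (A := A) (C := C)
  rw [← hf x, ← hf y]
  simp [h]

theorem eq_of_forall_rightDual [Module Aᵐᵒᵖ C] [Module.Finite Aᵐᵒᵖ C] [Module.Projective Aᵐᵒᵖ C]
    {x y : C} (h : ∀ f : RightDual A C, f x = f y) : x = y := by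
  obtain ⟨n, e, f, hf⟩ := exists_rightDualBasis (A := A) (C := C)
  rw [← hf x, ← hf y]
  simp [h]

/-- A right dual basis of `C` over `A` splits `C` off a finite free right `A`-module. -/
theorem finite_projective_right [Module Aᵐᵒᵖ C] {n : ℕ} (e : Fin n → C) (f : Fin n → RightDual A C)
    (h : ∀ x, ∑ i, op (f i x) • e i = x) :
    Module.Finite Aᵐᵒᵖ C ∧ Module.Projective Aᵐᵒᵖ C := by
  let s : C →ₗ[Aᵐᵒᵖ] (Fin n → Aᵐᵒᵖ) :=
    { toFun := fun x i => op (f i x)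
      map_add' := fun x y => by ext i; simp
      map_smul' := fun a x => by
        obtain ⟨a, rfl⟩ := op_surjective a
        ext i; simp }
  let p : (Fin n → Aᵐᵒᵖ) →ₗ[Aᵐᵒᵖ] C := Fintype.linearCombination Aᵐᵒᵖ e
  have hps : p ∘ₗ s = LinearMap.id := LinearMap.ext fun x => by
    simpa [p, s, Fintype.linearCombination_apply] using h x
  exact ⟨Module.Finite.of_surjective p fun x => ⟨s x, LinearMap.congr_fun hps x⟩,
    Module.Projective.of_split s p hps⟩

end dualBasis

/-! ### The scalars of A inside *C and C*. -/

section

variable {A C : Type*} [Ring A] [AddCommGroup C] [Module A C] [Module Aᵐᵒᵖ C]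
  [SMulCommClass A Aᵐᵒᵖ C] [Coring A C]

theorem LeftDual.mul_op_smul (f g : LeftDual A C) (a : A) : f * (op a • g) = op a • (f * g) := rfl

theorem actR_op_smul (f : LeftDual A C) (a : A) (c : C) :
    actR (op a • f) c = op a • actR f c := by
  simp only [actR_apply]
  exact hom_congr (f := NCTensor.contractRight (op a • f : LeftDual A C).toLin)
    (g := (DistribSMul.toAddMonoidHom C (op a)).comp (NCTensor.contractRight f.toLin))
    (fun x y => by simp [mul_smul]) _

theorem actR_sum {ι : Type*} (s : Finset ι) (f : ι → LeftDual A C) (c : C) :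
    actR (∑ i ∈ s, f i) c = ∑ i ∈ s, actR (f i) c :=
  _root_.map_sum (⟨⟨fun f => actR f c, actR_zero c⟩, fun f g => actR_add f g c⟩ :
    LeftDual A C →+ C) f s

theorem actL_sum {ι : Type*} (s : Finset ι) (f : ι → RightDual A C) (c : C) :
    actL (∑ i ∈ s, f i) c = ∑ i ∈ s, actL (f i) c :=
  _root_.map_sum (⟨⟨fun f => actL f c, actL_zero c⟩, fun f g => actL_add f g c⟩ :
    RightDual A C →+ C) f s

/-- The form `c ↦ a ε(c)`. -/
def RightDual.ofScalar (a : A) : RightDual A C :=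
  ({ toFun := fun c => a * counit (A := A) c
     map_add' := fun x y => by simp [mul_add]
     map_smul' := fun b x => by
      obtain ⟨b, rfl⟩ := op_surjective b
      simp [counit_op_smul, mul_assoc] } : C →ₗ[Aᵐᵒᵖ] A)

theorem RightDual.ofScalar_apply (a : A) (c : C) :
    RightDual.ofScalar a c = a * counit (A := A) c := rfl

theorem actL_ofScalar (a : A) (c : C) : actL (RightDual.ofScalar a) c = a • c := by
  conv_rhs => rw [← actL_one (A := A) c]
  simp only [actL_apply]
  exact hom_congr (f := contractLeft (RightDual.ofScalar a : RightDual A C).toLin)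
    (g := (DistribSMul.toAddMonoidHom C a).comp (contractLeft (1 : RightDual A C).toLin))
    (fun x y => by simp [RightDual.ofScalar_apply, RightDual.one_apply, mul_smul]) _

theorem RightDual.ofScalar_mul_apply (a : A) (f : RightDual A C) (c : C) :
    (RightDual.ofScalar a * f : RightDual A C) c = a * f c := by
  rw [RightDual.mul_apply, RightDual.ofScalar_apply, counit_actL]

theorem RightDual.mul_ofScalar_apply (a : A) (f : RightDual A C) (c : C) :
    (f * RightDual.ofScalar a : RightDual A C) c = f (a • c) := by
  rw [RightDual.mul_apply, actL_ofScalar]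

theorem RightDual.ofScalar_add (a b : A) :
    (RightDual.ofScalar (a + b) : RightDual A C) = RightDual.ofScalar a + RightDual.ofScalar b := by
  ext c
  simp [RightDual.ofScalar_apply, add_mul]

theorem RightDual.ofScalar_mul (a b : A) :
    (RightDual.ofScalar (a * b) : RightDual A C) = RightDual.ofScalar a * RightDual.ofScalar b := by
  ext c
  rw [RightDual.ofScalar_mul_apply, RightDual.ofScalar_apply, RightDual.ofScalar_apply, mul_assoc]

theorem RightDual.ofScalar_zero : (RightDual.ofScalar 0 : RightDual A C) = 0 := by
  ext c
  simp [RightDual.ofScalar_apply]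

/-- The right A-action on *C is right multiplication by the form ε a, so right *C-linear maps are
automatically right A-linear. -/
theorem LeftDual.mul_op_smul_one (a : A) (f : LeftDual A C) :
    f * (op a • (1 : LeftDual A C)) = op a • f := by
  rw [LeftDual.mul_op_smul, mul_one]

theorem actR_op_smul_one (a : A) (c : C) : actR (op a • (1 : LeftDual A C)) c = op a • c := by
  rw [actR_op_smul, actR_one]

end

/-! ### The module Q and Morita bases. -/

section moritaQ

variable {A C : Type u} [Ring A] [AddCommGroup C] [Module A C] [Module Aᵐᵒᵖ C]
  [SMulCommClass A Aᵐᵒᵖ C] [Coring A C]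

@[simp] theorem evalAt_apply (q : C →ₗ[Aᵐᵒᵖ] LeftDual A C) (c x : C) : evalAt q c x = q x c := rfl

theorem actL_evalAt (q : moritaQ A C) (x c : C) : actL (evalAt q.1 c) x = actR (q.1 x) c := q.2 x c

theorem evalAt_add (q : C →ₗ[Aᵐᵒᵖ] LeftDual A C) (c d : C) :
    evalAt q (c + d) = evalAt q c + evalAt q d := by
  ext x
  simp

/-- Apply f to both sides of q(x₍₁₎)(c) x₍₂₎ = c₍₁₎ q(x)(c₍₂₎): the left side becomes q(x · f)(c),
the right side (q(x) * f)(c). -/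
theorem moritaQ_actR (q : moritaQ A C) (f : LeftDual A C) (x : C) :
    q.1 (actR f x) = q.1 x * f := by
  ext c
  have h : ∀ t : NCTensor A C C, q.1 (NCTensor.contractRight f.toLin t) c =
      f (contractLeft (evalAt q.1 c).toLin t) :=
    hom_congr (f := (evalAt q.1 c).toLin.toAddMonoidHom.comp (NCTensor.contractRight f.toLin))
      (g := f.toLin.toAddMonoidHom.comp (contractLeft (evalAt q.1 c).toLin))
      fun x y => by simp
  rw [LeftDual.mul_apply, ← actL_evalAt, actR_apply, actL_apply, h]

/-- The mirror image: here the right linear form f is applied to both sides of the identity defining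
Q. -/
theorem evalAt_actL (q : moritaQ A C) (f : RightDual A C) (c : C) :
    evalAt q.1 (actL f c) = f * evalAt q.1 c := by
  ext x
  have h : ∀ t : NCTensor A C C, q.1 x (contractLeft f.toLin t) =
      f (NCTensor.contractRight (q.1 x).toLin t) :=
    hom_congr (f := (q.1 x).toLin.toAddMonoidHom.comp (contractLeft f.toLin))
      (g := f.toLin.toAddMonoidHom.comp (NCTensor.contractRight (q.1 x).toLin))
      fun x y => by simp
  rw [RightDual.mul_apply, actL_evalAt, evalAt_apply, actR_apply, actL_apply, h]

/-- For `q` in `Q`, the left `C*`-linear map `C → C*`, `c ↦ (x ↦ q(x)(c))`. -/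
def toRightDual (q : moritaQ A C) : C →ₗ[RightDual A C] RightDual A C where
  toFun := evalAt q.1
  map_add' := evalAt_add q.1
  map_smul' f c := evalAt_actL q f c

@[simp] theorem toRightDual_apply (q : moritaQ A C) (c : C) : toRightDual q c = evalAt q.1 c := rfl

/-- For `q` in `Q`, the right `*C`-linear map `q : C → *C`. -/
def toLeftDual (q : moritaQ A C) : C →ₗ[(LeftDual A C)ᵐᵒᵖ] LeftDual A C where
  toFun := q.1
  map_add' := _root_.map_add q.1
  map_smul' f c := by
    obtain ⟨f, rfl⟩ := op_surjective f
    exact moritaQ_actR q f c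

/-- *C-linearity of g is the identity defining Q after application of an arbitrary left form f, and
such forms separate points when C is finitely generated projective on the left. -/
theorem exists_toLeftDual_eq [Module.Finite A C] [Module.Projective A C]
    (g : C →ₗ[(LeftDual A C)ᵐᵒᵖ] LeftDual A C) : ∃ q : moritaQ A C, toLeftDual q = g := by
  have hg : ∀ (f : LeftDual A C) (x : C), g (actR f x) = g x * f := fun f x =>
    _root_.map_smul g (op f) x
  let q : C →ₗ[Aᵐᵒᵖ] LeftDual A C :=
    { toFun := g
      map_add' := _root_.map_add g
      map_smul' := fun a x => by
        obtain ⟨a, rfl⟩ := op_surjective a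
        rw [← actR_op_smul_one, hg, LeftDual.mul_op_smul_one]; rfl }
  refine ⟨⟨q, fun x c => eq_of_forall_leftDual (A := A) fun f => ?_⟩, rfl⟩
  have h : ∀ t : NCTensor A C C, q (NCTensor.contractRight f.toLin t) c =
      f (contractLeft (evalAt q c).toLin t) :=
    hom_congr (f := (evalAt q c).toLin.toAddMonoidHom.comp (NCTensor.contractRight f.toLin))
      (g := f.toLin.toAddMonoidHom.comp (contractLeft (evalAt q c).toLin))
      fun x y => by simp
  exact (h _).symm.trans (congrArg (fun k : LeftDual A C => k c) (hg f x))

/-- As before with the sides exchanged: right forms separate points. Left A-linearity of c ↦ g(c)(x)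
comes from the scalars a ε in C*. -/
theorem exists_toRightDual_eq [Module.Finite Aᵐᵒᵖ C] [Module.Projective Aᵐᵒᵖ C]
    (g : C →ₗ[RightDual A C] RightDual A C) : ∃ q : moritaQ A C, toRightDual q = g := by
  have hg : ∀ (f : RightDual A C) (x : C), g (actL f x) = f * g x := fun f x =>
    _root_.map_smul g f x
  let q : C →ₗ[Aᵐᵒᵖ] LeftDual A C :=
    { toFun := fun x =>
        ({ toFun := fun c => g c x
           map_add' := fun c d => by simp
           map_smul' := fun a c => by
            rw [← actL_ofScalar, hg, RightDual.ofScalar_mul_apply]; rfl } : C →ₗ[A] A)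
      map_add' := fun x y => LeftDual.ext fun c => RightDual.map_add (g c) x y
      map_smul' := fun a x => LeftDual.ext fun c => by
        obtain ⟨a, rfl⟩ := op_surjective a
        exact RightDual.map_op_smul (g c) a x }
  have hq : ∀ x c, q x c = g c x := fun _ _ => rfl
  refine ⟨⟨q, fun x c => eq_of_forall_rightDual (A := A) fun f => ?_⟩, rfl⟩
  have h : ∀ t : NCTensor A C C, q x (contractLeft f.toLin t) =
      f (NCTensor.contractRight (q x).toLin t) :=
    hom_congr (f := (q x).toLin.toAddMonoidHom.comp (contractLeft f.toLin))
      (g := f.toLin.toAddMonoidHom.comp (NCTensor.contractRight (q x).toLin))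
      fun x y => by simp
  exact (congrArg (fun k : RightDual A C => k x) (hg f c)).symm.trans (h _)

variable (A C) in
/-- A finite family of `cᵢ` in `C` and `qᵢ` in `Q` such that `x = ∑ cᵢ · qᵢ(x)` for all `x`. -/
structure MoritaBasis where
  n : ℕ
  elt : Fin n → C
  form : Fin n → moritaQ A C
  sum_actR : ∀ x, ∑ i, actR ((form i).1 x) (elt i) = x

namespace MoritaBasis

theorem sum_apply (b : MoritaBasis A C) (x : C) :
    ∑ i, (b.form i).1 x (b.elt i) = counit (A := A) x := by
  conv_rhs => rw [← b.sum_actR x, _root_.map_sum]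
  simp only [counit_actR]

/-- The counit applied to the basis identity. In this form the basis says that the trace ideal of C
in C* contains 1. -/
theorem sum_evalAt (b : MoritaBasis A C) :
    ∑ i, evalAt (b.form i).1 (b.elt i) = (1 : RightDual A C) := by
  ext x
  rw [RightDual.sum_apply]
  exact b.sum_apply x

theorem of_sum_evalAt {n : ℕ} (c : Fin n → C) (q : Fin n → moritaQ A C)
    (h : ∑ i, evalAt (q i).1 (c i) = (1 : RightDual A C)) : Nonempty (MoritaBasis A C) := by
  refine ⟨⟨n, c, q, fun x => ?_⟩⟩
  simp only [← actL_evalAt]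
  rw [← actL_sum, h, actL_one]

end MoritaBasis

/-- With a left dual basis (eₖ, fₖ), qᵢ(x) = ∑ₖ fₖ · qᵢ(x)(eₖ), so x = ∑ (cᵢ · fₖ) qᵢ(x)(eₖ). The
elements cᵢ · fₖ and the right linear forms x ↦ qᵢ(x)(eₖ) are a right dual basis. -/
theorem MoritaBasis.rightFinite [Module.Finite A C] [Module.Projective A C]
    (b : MoritaBasis A C) : Module.Finite Aᵐᵒᵖ C ∧ Module.Projective Aᵐᵒᵖ C := by
  obtain ⟨m, e, f, hf⟩ := exists_leftDualBasis (A := A) (C := C)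
  have key : ∀ g : LeftDual A C, g = ∑ k, op (g (e k)) • f k := fun g => by
    ext c
    conv_lhs => rw [← hf c, LeftDual.map_sum]
    rw [LeftDual.sum_apply]
    simp
  let ε := (finProdFinEquiv : Fin b.n × Fin m ≃ _)
  refine finite_projective_right (A := A) (n := b.n * m)
    (fun j => actR (f (ε.symm j).2) (b.elt (ε.symm j).1))
    (fun j => evalAt (b.form (ε.symm j).1).1 (e (ε.symm j).2)) fun x => ?_
  rw [ε.symm.sum_comp (fun ij => op (evalAt (b.form ij.1).1 (e ij.2) x) •
    actR (f ij.2) (b.elt ij.1)), Fintype.sum_prod_type]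
  conv_rhs => rw [← b.sum_actR x]
  refine Finset.sum_congr rfl fun i _ => ?_
  conv_rhs => rw [key ((b.form i).1 x), actR_sum]
  simp only [actR_op_smul, evalAt_apply]

/-- The components of the inclusion C → (*C)ⁿ are *C-linear, hence elements of Q; the cᵢ are the
images of the standard basis under the retraction. -/
theorem MoritaBasis.of_isLeftQuasiFrobenius [Module.Finite A C] [Module.Projective A C]
    (h : IsLeftQuasiFrobenius A C) : Nonempty (MoritaBasis A C) := by
  obtain ⟨n, i, p, hpi⟩ := h
  choose q hq using fun k => exists_toLeftDual_eq (A := A) (LinearMap.proj k ∘ₗ i)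
  refine ⟨⟨n, fun k => p (Pi.single k 1), q, fun x => ?_⟩⟩
  conv_rhs => rw [← LinearMap.id_apply (R := (LeftDual A C)ᵐᵒᵖ) x, ← hpi, LinearMap.comp_apply]
  have h1 : i x = ∑ k, op (i x k) • (Pi.single k 1 : Fin n → LeftDual A C) := by
    ext1 j
    simp [Finset.sum_apply, Pi.single_apply]
  rw [h1, _root_.map_sum]
  refine Finset.sum_congr rfl fun k _ => ?_
  rw [_root_.map_smul, op_smul_eq]
  exact congrArg (fun g : LeftDual A C => actR g _) (LinearMap.congr_fun (hq k) x)

theorem MoritaBasis.isLeftQuasiFrobenius (b : MoritaBasis A C) : IsLeftQuasiFrobenius A C := by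
  refine ⟨b.n, LinearMap.pi fun k => toLeftDual (b.form k),
    { toFun := fun f => ∑ k, actR (f k) (b.elt k)
      map_add' := fun f g => by simp [actR_add, Finset.sum_add_distrib]
      map_smul' := fun g f => by
        obtain ⟨g, rfl⟩ := op_surjective g
        simp [actR_mul] }, LinearMap.ext fun x => b.sum_actR x⟩

/-! ### The map ▽ of the Morita context. -/

theorem colin_actR (φ : (RightComodule.self A C).colin (RightComodule.self A C)) (f : LeftDual A C)
    (x : C) : φ.1 (actR f x) = actR f (φ.1 x) := by
  have h := congrArg (NCTensor.contractRight f.toLin) (φ.2 x)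
  rw [contractRight_tensorMap] at h
  exact h.symm

/-- Since φ commutes with *C, φ(x) = ∑ φ(cᵢ) · qᵢ(x), which exhibits ∑ φ(cᵢ) ⊗ qᵢ as a preimage. -/
theorem MoritaBasis.triangle_surjective (b : MoritaBasis A C) :
    Function.Surjective (triangle A C) := fun φ => by
  refine ⟨∑ i, tmul (LeftDual A C) (φ.1 (b.elt i)) (b.form i), Subtype.ext (LinearMap.ext fun x => ?_)⟩
  have h : (show C →ₗ[Aᵐᵒᵖ] C from φ.1) x = ∑ i, actR ((b.form i).1 x) (φ.1 (b.elt i)) := by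
    conv_lhs => rw [← b.sum_actR x, _root_.map_sum]
    exact Finset.sum_congr rfl fun i _ => colin_actR φ _ _
  rw [_root_.map_sum, AddSubgroup.val_finsetSum, LinearMap.sum_apply]
  exact h.symm

theorem exists_sum_tmul {R M N : Type*} [Ring R] [AddCommGroup M] [AddCommGroup N]
    [Module Rᵐᵒᵖ M] [Module R N] (t : NCTensor R M N) :
    ∃ (n : ℕ) (x : Fin n → M) (y : Fin n → N), t = ∑ i, tmul R (x i) (y i) := by
  induction t using NCTensor.induction with
  | h0 => exact ⟨0, Fin.elim0, Fin.elim0, by simp⟩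
  | ht m n => exact ⟨1, fun _ => m, fun _ => n, by simp⟩
  | ha s t hs ht =>
    obtain ⟨n, x, y, rfl⟩ := hs
    obtain ⟨m, x', y', rfl⟩ := ht
    exact ⟨n + m, Fin.append x x', Fin.append y y', by simp [Fin.sum_univ_add]⟩

theorem MoritaBasis.of_triangle_surjective (h : Function.Surjective (triangle A C)) :
    Nonempty (MoritaBasis A C) := by
  obtain ⟨t, ht⟩ := h (𝟙 (RightComodule.self A C))
  obtain ⟨n, c, q, rfl⟩ := exists_sum_tmul t
  refine ⟨⟨n, c, q, fun x => ?_⟩⟩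
  have := congrArg (fun φ : (RightComodule.self A C).colin (RightComodule.self A C) => φ.1 x) ht
  dsimp only at this
  rw [_root_.map_sum, AddSubgroup.val_finsetSum, LinearMap.sum_apply] at this
  exact this

/-- The usual Morita argument: expand each cⱼ of the tensor in the basis and move the coefficients
across, so that the right factors become values of the given tensor under ▽, hit by qᵢ. -/
theorem MoritaBasis.triangle_bijective (b : MoritaBasis A C) :
    Function.Bijective (triangle A C) := by
  refine ⟨(injective_iff_map_eq_zero _).2 fun t ht => ?_, b.triangle_surjective⟩
  obtain ⟨n, c, q, rfl⟩ := exists_sum_tmul t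
  have h0 : ∀ y, ∑ j, actR ((q j).1 y) (c j) = 0 := fun y => by
    have := congrArg (fun φ : (RightComodule.self A C).colin (RightComodule.self A C) => φ.1 y) ht
    dsimp only at this
    rw [_root_.map_sum, AddSubgroup.val_finsetSum, LinearMap.sum_apply] at this
    exact this
  -- By *C-linearity of qᵢ, the value at y is qᵢ(∑ⱼ cⱼ · qⱼ(y)) = qᵢ(0).
  have h1 : ∀ i, ∑ j, (b.form i).1 (c j) • q j = 0 := fun i => by
    refine Subtype.ext (LinearMap.ext fun y => ?_)
    rw [AddSubgroup.val_finsetSum, LinearMap.sum_apply]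
    refine (Finset.sum_congr rfl fun j _ =>
      (moritaQ_actR (b.form i) ((q j).1 y) (c j)).symm).trans ?_
    rw [← _root_.map_sum, h0, _root_.map_zero]
    rfl
  calc ∑ j, tmul (LeftDual A C) (c j) (q j)
      = ∑ j, ∑ i, tmul (LeftDual A C) (b.elt i) ((b.form i).1 (c j) • q j) := by
        refine Finset.sum_congr rfl fun j _ => ?_
        conv_lhs => rw [← b.sum_actR (c j)]
        simp only [← smul_tmul, op_smul_eq]
        exact _root_.map_sum ((mkHom (LeftDual A C) (M := C) (N := moritaQ A C)).flip (q j)) _ _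
    _ = ∑ i, tmul (LeftDual A C) (b.elt i) (∑ j, (b.form i).1 (c j) • q j) := by
        rw [Finset.sum_comm]
        exact Finset.sum_congr rfl fun i _ =>
          (_root_.map_sum (mkHom (LeftDual A C) (N := moritaQ A C) (b.elt i)) _ _).symm
    _ = 0 := by simp [h1, tmul_zero]

end moritaQ

end Coring

/-! ### Finite presentation, and splitting of pure monomorphisms. -/

/-- The coordinates fᵢ give a B-linear section T of Sᶥ → M. Since S is finitely generated over B,
the kernel is generated by the finitely many relations that rewrite sⱼ eᵢ in its coordinates. -/
theorem Module.FinitePresentation.of_ringHom_coordinates {B S M ι κ : Type*} [Ring B] [Ring S]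
    [AddCommGroup M] [Module S M] [Fintype ι] [Fintype κ] (θ : B →+* S) (e : ι → M)
    (f : ι → M →+ B) (hf : ∀ i b x, f i (θ b • x) = b * f i x)
    (hfe : ∀ x, ∑ i, θ (f i x) • e i = x) (s : κ → S)
    (hs : ∀ t : S, ∃ b : κ → B, t = ∑ j, θ (b j) * s j) : Module.FinitePresentation S M := by
  classical
  let π : (ι → S) →ₗ[S] M := Fintype.linearCombination S e
  let T : M →+ (ι → S) :=
    { toFun := fun x i => θ (f i x)
      map_zero' := by ext i; simp
      map_add' := fun x y => by ext i; simp }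
  have hπT : ∀ x, π (T x) = x := fun x => by
    simpa [π, T, Fintype.linearCombination_apply] using hfe x
  have hT : ∀ b x, T (θ b • x) = θ b • T x := fun b x => by ext i; simp [T, hf]
  let w : ι × κ → (ι → S) := fun p => Pi.single p.1 (s p.2) - T (s p.2 • e p.1)
  have hπ : ∀ i t, π (Pi.single i t) = t • e i := fun i t => by
    simp [π, Fintype.linearCombination_apply_single]
  have hker : LinearMap.ker π = Submodule.span S (Set.range w) := by
    refine le_antisymm (fun v hv => ?_) (Submodule.span_le.2 ?_)
    · choose b hb using fun i => hs (v i)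
      -- Both v and T(π v) are θ(B)-combinations with the same coefficients; for v in the kernel the
      -- term T(π v) vanishes.
      have key : v - T (π v) = ∑ i, ∑ j, θ (b i j) • w (i, j) := by
        have hv' : v = ∑ i, ∑ j, θ (b i j) • (Pi.single i (s j) : ι → S) := by
          ext l
          simp [Finset.sum_apply, Pi.single_apply, hb l]
        have h2 : T (π v) = ∑ i, ∑ j, θ (b i j) • T (s j • e i) := by
          conv_lhs => rw [hv']
          simp only [map_sum, map_smul, hπ, hT]
        rw [h2]
        conv_lhs => rw [hv']
        simp only [w, smul_sub, Finset.sum_sub_distrib]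
      rw [LinearMap.mem_ker.1 hv, map_zero, sub_zero] at key
      rw [key]
      exact Submodule.sum_mem _ fun i _ => Submodule.sum_mem _ fun j _ =>
        Submodule.smul_mem _ _ (Submodule.subset_span ⟨_, rfl⟩)
    · rintro _ ⟨p, rfl⟩
      simp [w, hπ, hπT]
  refine Module.finitePresentation_of_surjective π (fun x => ⟨T x, hπT x⟩) ?_
  rw [hker]
  exact Submodule.fg_span (Set.finite_range w)

namespace NCTensor

theorem tmul_sum (R : Type*) {M N ι : Type*} [Ring R] [AddCommGroup M] [AddCommGroup N]
    [Module Rᵐᵒᵖ M] [Module R N] (s : Finset ι) (m : M) (n : ι → N) :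
    tmul R m (∑ i ∈ s, n i) = ∑ i ∈ s, tmul R m (n i) :=
  map_sum (mkHom R (N := N) m) n s

theorem sum_tmul (R : Type*) {M N ι : Type*} [Ring R] [AddCommGroup M] [AddCommGroup N]
    [Module Rᵐᵒᵖ M] [Module R N] (s : Finset ι) (m : ι → M) (n : N) :
    tmul R (∑ i ∈ s, m i) n = ∑ i ∈ s, tmul R (m i) n :=
  map_sum ((mkHom R (M := M) (N := N)).flip n) m s

theorem neg_tmul (R : Type*) {M N : Type*} [Ring R] [AddCommGroup M] [AddCommGroup N]
    [Module Rᵐᵒᵖ M] [Module R N] (m : M) (n : N) : tmul R (-m) n = -tmul R m n :=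
  map_neg ((mkHom R (M := M) (N := N)).flip n) m

end NCTensor

open NCTensor in
/-- If `R → M`, `r ↦ r m` is a pure monomorphism and `M` is finitely presented, then it splits. -/
theorem exists_linearMap_apply_eq_one {R M : Type u} [Ring R] [AddCommGroup M] [Module R M]
    [Module.FinitePresentation R M] (m : M)
    (h : ∀ (N : Type u) [AddCommGroup N] [Module Rᵐᵒᵖ N] (n : N), tmul R n m = 0 → n = 0) :
    ∃ φ : M →ₗ[R] R, φ m = 1 := by
  classical
  obtain ⟨l, k, f, g, hf, hfg⟩ := Module.FinitePresentation.exists_fin' R M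
  obtain ⟨u, hu⟩ := hf m
  let w : Fin k → Fin l → R := fun j => g (Pi.single j 1)
  -- Present M as Rˡ modulo the rows wⱼ, with m the class of u. The test module is the cokernel of v
  -- ↦ (u·v, wⱼ·v), built so that the class of (1, 0) is killed by ⊗ m; its vanishing solves u·v =
  -- 1, wⱼ·v = 0.
  let D : (Fin l → R) →ₗ[Rᵐᵒᵖ] R × (Fin k → R) :=
    { toFun := fun v => (∑ i, u i * v i, fun j => ∑ i, w j i * v i)
      map_add' := fun v v' => by
        ext <;> simp [mul_add, Finset.sum_add_distrib]
      map_smul' := fun r v => by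
        obtain ⟨r, rfl⟩ := op_surjective r
        ext <;> simp [Finset.sum_mul, mul_assoc] }
  let mk := (LinearMap.range D).mkQ
  have hD : ∀ v, mk (D v) = 0 := fun v =>
    (Submodule.Quotient.mk_eq_zero _).2 ⟨v, rfl⟩
  have hm : ∀ v : Fin l → R, f v = ∑ i, v i • f (Pi.single i 1) := fun v => by
    conv_lhs => rw [pi_eq_sum_univ' v]
    simp
  have hw : ∀ j, ∑ i, w j i • f (Pi.single i 1) = 0 := fun j => by
    rw [← hm]
    exact hfg.apply_apply_eq_zero _
  have h1 : ∀ i, op (u i) • mk (1, 0) = -∑ j, op (w j i) • mk (0, Pi.single j 1) := fun i => by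
    rw [eq_neg_iff_add_eq_zero, ← hD (Pi.single i 1)]
    simp only [← map_smul, ← map_sum, ← map_add]
    congr 1
    ext j
    · simp [D, Prod.fst_sum, Pi.single_apply]
    · simp [D, Prod.snd_sum, Pi.single_apply, Finset.sum_apply]
  -- Moving uᵢ across the tensor and using the relations of the cokernel leaves the terms (0, 1ⱼ) ⊗
  -- ∑ᵢ wⱼᵢ eᵢ, which are zero in M.
  have h2 : tmul R (mk (1, 0)) m = 0 := by
    rw [← hu, hm u, tmul_sum]
    simp only [← smul_tmul, h1, neg_tmul, sum_tmul, Finset.sum_neg_distrib]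
    rw [Finset.sum_comm]
    simp only [smul_tmul, ← tmul_sum, hw, tmul_zero, Finset.sum_const_zero, neg_zero]
  obtain ⟨v, hv⟩ := (Submodule.Quotient.mk_eq_zero _).1 (h _ _ h2)
  have hv1 : ∑ i, u i * v i = 1 := congrArg Prod.fst hv
  have hv2 : ∀ j, ∑ i, w j i * v i = 0 := fun j => congrFun (congrArg Prod.snd hv) j
  -- The solution v is a form on Rˡ that kills the relations and takes the value 1 at u, so it
  -- descends to M.
  let ψ : (Fin l → R) →ₗ[R] R := Fintype.linearCombination R v
  have hψ : LinearMap.ker f ≤ LinearMap.ker ψ := fun x hx => by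
    obtain ⟨y, rfl⟩ := (hfg x).1 hx
    rw [LinearMap.mem_ker, pi_eq_sum_univ' y]
    have : ∀ j, ψ (g (Pi.single j 1)) = 0 := fun j => by
      simpa [ψ, Fintype.linearCombination_apply] using hv2 j
    simp [this]
  refine ⟨(LinearMap.ker f).liftQ ψ hψ ∘ₗ (f.quotKerEquivOfSurjective hf).symm.toLinearMap, ?_⟩
  have h3 : (f.quotKerEquivOfSurjective hf).symm m = (LinearMap.ker f).mkQ u := by
    rw [LinearEquiv.symm_apply_eq, ← hu]
    rfl
  rw [LinearMap.comp_apply, LinearEquiv.coe_coe, h3, Submodule.mkQ_apply, Submodule.liftQ_apply]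
  simpa [ψ, Fintype.linearCombination_apply] using hv1

/-! ### C over its dual rings, and the functor - ⊗_{C*} C. -/

namespace Coring

open NCTensor

variable {A C : Type u} [Ring A] [AddCommGroup C] [Module A C] [Module Aᵐᵒᵖ C]
  [SMulCommClass A Aᵐᵒᵖ C] [Coring A C]

variable (A C) in
/-- The ring homomorphism `A → C*`, `a ↦ a ε`. -/
def ofScalarHom : A →+* RightDual A C where
  toFun := RightDual.ofScalar
  map_one' := by ext c; simp [RightDual.ofScalar_apply, RightDual.one_apply]
  map_mul' := RightDual.ofScalar_mul
  map_zero' := RightDual.ofScalar_zero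
  map_add' := RightDual.ofScalar_add

variable (A C) in
/-- The ring homomorphism `Aᵐᵒᵖ → *Cᵐᵒᵖ`, `a ↦ ε a`. -/
def opScalarHom : Aᵐᵒᵖ →+* (LeftDual A C)ᵐᵒᵖ where
  toFun a := op (a • (1 : LeftDual A C))
  map_one' := by rw [one_smul, op_one]
  map_mul' a b := by
    obtain ⟨a, rfl⟩ := op_surjective a
    exact congrArg op ((mul_smul _ _ _).trans (LeftDual.mul_op_smul_one _ _).symm)
  map_zero' := by rw [zero_smul, op_zero]
  map_add' a b := by rw [add_smul, MulOpposite.op_add]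

/-- Over A, C has coordinates from a left dual basis, and C* is spanned by the forms of a right dual
basis (dⱼ, gⱼ) because t = ∑ t(dⱼ) gⱼ. -/
theorem finitePresentation_rightDual [Module.Finite A C] [Module.Projective A C]
    [Module.Finite Aᵐᵒᵖ C] [Module.Projective Aᵐᵒᵖ C] :
    Module.FinitePresentation (RightDual A C) C := by
  obtain ⟨n, e, f, hf⟩ := exists_leftDualBasis (A := A) (C := C)
  obtain ⟨m, d, g, hg⟩ := exists_rightDualBasis (A := A) (C := C)
  refine Module.FinitePresentation.of_ringHom_coordinates (ofScalarHom A C) e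
    (fun i => (f i).toLin.toAddMonoidHom) (fun i b x => ?_) (fun x => ?_) g fun t =>
    ⟨fun j => t (d j), ?_⟩
  · exact (congrArg (f i) (actL_ofScalar b x)).trans (LeftDual.map_smul _ _ _)
  · refine Eq.trans (Finset.sum_congr rfl fun i _ => ?_) (hf x)
    exact actL_ofScalar _ _
  · ext x
    conv_lhs => rw [← hg x, RightDual.map_sum]
    rw [RightDual.sum_apply]
    refine Finset.sum_congr rfl fun i _ => ?_
    exact (RightDual.map_op_smul _ _ _).trans (RightDual.ofScalar_mul_apply _ _ _).symm

/-- The roles of the two dual bases are exchanged: the right one gives coordinates on C, the left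
one spans *C. -/
theorem finitePresentation_leftDual [Module.Finite A C] [Module.Projective A C]
    [Module.Finite Aᵐᵒᵖ C] [Module.Projective Aᵐᵒᵖ C] :
    Module.FinitePresentation (LeftDual A C)ᵐᵒᵖ C := by
  obtain ⟨n, e, f, hf⟩ := exists_leftDualBasis (A := A) (C := C)
  obtain ⟨m, d, g, hg⟩ := exists_rightDualBasis (A := A) (C := C)
  have hθ : ∀ (b : Aᵐᵒᵖ) (x : C), opScalarHom A C b • x = b • x := fun b x => by
    obtain ⟨b, rfl⟩ := op_surjective b
    exact actR_op_smul_one b x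
  refine Module.FinitePresentation.of_ringHom_coordinates (opScalarHom A C) d
    (fun i => (opAddEquiv.toAddMonoidHom).comp (g i).toLin.toAddMonoidHom) (fun i b x => ?_)
    (fun x => ?_) (fun i => op (f i)) fun t => ⟨fun j => op (unop t (e j)), ?_⟩
  · rw [hθ]
    obtain ⟨b, rfl⟩ := op_surjective b
    exact congrArg op (RightDual.map_op_smul (g i) b x)
  · refine Eq.trans (Finset.sum_congr rfl fun i _ => ?_) (hg x)
    exact hθ _ _
  · obtain ⟨t, rfl⟩ := op_surjective t
    refine unop_injective ?_
    rw [Finset.unop_sum]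
    ext x
    conv_lhs => rw [unop_op, ← hf x, LeftDual.map_sum]
    rw [LeftDual.sum_apply]
    refine Finset.sum_congr rfl fun i _ => ?_
    rw [LeftDual.map_smul]
    exact congrArg (fun h : LeftDual A C => h x)
      (LeftDual.mul_op_smul_one (t (e i)) (f i)).symm

/-- Contracting z ⊗ cᵢ with qᵢ and summing gives z · ∑ qᵢ(-)(cᵢ) = z, so the tensors z ⊗ cᵢ
determine z. -/
theorem MoritaBasis.eq_of_tmul_eq (b : MoritaBasis A C) {M : Type*} [AddCommGroup M]
    [Module (RightDual A C)ᵐᵒᵖ M] {x y : M}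
    (h : ∀ c : C, tmul (RightDual A C) x c = tmul (RightDual A C) y c) : x = y := by
  have key : ∀ z : M, ∑ i, NCTensor.contractRight (toRightDual (b.form i))
      (tmul (RightDual A C) z (b.elt i)) = z := fun z => by
    simp only [contractRight_tmul, toRightDual_apply]
    rw [← Finset.sum_smul, ← Finset.op_sum, b.sum_evalAt, op_one, one_smul]
  rw [← key x, ← key y]
  simp only [h]

theorem MoritaBasis.inducedFunctor_faithful (b : MoritaBasis A C) :
    (inducedFunctor A C).Faithful where
  map_injective {X Y} f g h := by
    refine ModuleCat.hom_ext (LinearMap.ext fun x => b.eq_of_tmul_eq fun c => ?_)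
    exact congrArg (fun k : (inducedObj A C X).colin (inducedObj A C Y) =>
      k.1 (tmul (RightDual A C) x c)) h

theorem contractRight_inducedCoact_tmul {M : Type u} [AddCommGroup M]
    [Module (RightDual A C)ᵐᵒᵖ M] (f : LeftDual A C) (m : M) (c : C) :
    NCTensor.contractRight f.toLin (inducedCoact A C M (tmul (RightDual A C) m c)) =
      tmul (RightDual A C) m (actR f c) := by
  rw [inducedCoact_tmul, contractRight_tensorMap]
  rfl

/-- On t = m ⊗ d both sides are m ⊗ (d · q(c)), by the identity defining Q. The right side uses only
the coaction, so colinear maps are compatible with it. -/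
theorem contractRight_toRightDual_tmul {M : Type u} [AddCommGroup M]
    [Module (RightDual A C)ᵐᵒᵖ M] (q : moritaQ A C) (t : NCTensor (RightDual A C) M C) (c : C) :
    tmul (RightDual A C) (NCTensor.contractRight (toRightDual q) t) c =
      NCTensor.contractRight (q.1 c).toLin (inducedCoact A C M t) :=
  hom_congr (f := ((mkHom (RightDual A C) (M := M)).flip c).comp
      (NCTensor.contractRight (toRightDual q)))
    (g := (NCTensor.contractRight (q.1 c).toLin).comp (inducedCoact A C M).toAddMonoidHom)
    (fun m d => by
      simp only [AddMonoidHom.comp_apply, LinearMap.toAddMonoidHom_coe, AddMonoidHom.flip_apply,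
        mkHom_apply, contractRight_inducedCoact_tmul, contractRight_tmul, smul_tmul, ← actL_evalAt]
      rfl) t

theorem MoritaBasis.inducedFunctor_full (b : MoritaBasis A C) : (inducedFunctor A C).Full where
  map_surjective {X Y} G := by
    let G' : NCTensor (RightDual A C) X C →ₗ[Aᵐᵒᵖ] NCTensor (RightDual A C) Y C := G.1
    have hG : ∀ (f : LeftDual A C) (t : NCTensor (RightDual A C) X C),
        NCTensor.contractRight f.toLin (inducedCoact A C Y (G' t)) =
          G' (NCTensor.contractRight f.toLin (inducedCoact A C X t)) := fun f t => by
      have h := congrArg (NCTensor.contractRight f.toLin) (G.2 t)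
      rw [contractRight_tensorMap] at h
      exact h
    -- This formula is forced: if G = g ⊗ C, contracting g(x) ⊗ cᵢ with qᵢ and summing returns g(x).
    let g : X → Y := fun x => ∑ i, NCTensor.contractRight (toRightDual (b.form i))
      (G' (tmul (RightDual A C) x (b.elt i)))
    have hg : ∀ (x : X) (c : C),
        tmul (RightDual A C) (g x) c = G' (tmul (RightDual A C) x c) := fun x c => by
      simp only [g, sum_tmul, contractRight_toRightDual_tmul, hG, contractRight_inducedCoact_tmul]
      rw [← map_sum, ← tmul_sum, b.sum_actR]
    let g' : X →ₗ[(RightDual A C)ᵐᵒᵖ] Y :=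
      { toFun := g
        map_add' := fun x y => b.eq_of_tmul_eq fun c => by
          rw [hg, add_tmul, add_tmul, map_add, hg, hg]
        map_smul' := fun r x => b.eq_of_tmul_eq fun c => by
          obtain ⟨r, rfl⟩ := op_surjective r
          rw [hg, smul_tmul, RingHom.id_apply, smul_tmul, hg] }
    exact ⟨ModuleCat.ofHom g', Subtype.ext (LinearMap.ext fun t =>
      hom_congr (f := (inducedLin A C g').toAddMonoidHom) (g := G'.toAddMonoidHom) hg t)⟩

/-- The hypothesis on n says that r ↦ n r and the zero map C* → N become equal after - ⊗_{C*} C. -/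
theorem eq_zero_of_inducedFunctor_faithful (h : (inducedFunctor A C).Faithful) {N : Type u}
    [AddCommGroup N] [Module (RightDual A C)ᵐᵒᵖ N] {n : N}
    (hn : ∀ c : C, tmul (RightDual A C) n c = 0) : n = 0 := by
  let f : RightDual A C →ₗ[(RightDual A C)ᵐᵒᵖ] N :=
    { toFun := fun r => op r • n
      map_add' := fun r s => by rw [MulOpposite.op_add, add_smul]
      map_smul' := fun s r => by
        obtain ⟨s, rfl⟩ := op_surjective s
        rw [op_smul_eq_mul, op_mul, mul_smul, RingHom.id_apply] }
  have hf : (inducedFunctor A C).map (ModuleCat.ofHom f) =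
      (inducedFunctor A C).map (ModuleCat.ofHom 0) :=
    Subtype.ext (LinearMap.ext fun t =>
      hom_congr (f := (inducedLin A C f).toAddMonoidHom)
        (g := (inducedLin A C (0 : RightDual A C →ₗ[(RightDual A C)ᵐᵒᵖ] N)).toAddMonoidHom)
        (fun r c => (smul_tmul (RightDual A C) r n c).trans
          ((hn _).trans (zero_tmul (RightDual A C) c).symm)) t)
  have h1 := congrArg (fun k => k.hom (1 : RightDual A C)) (h.map_injective hf)
  have h2 : op (1 : RightDual A C) • n = 0 := h1
  rwa [op_one, one_smul] at h2

/-- Faithfulness makes r ↦ r d from C* to Cᵐ pure, so a form φ on Cᵐ has φ(d) = 1. The components of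
φ lie in Q, and φ(d) = ∑ qᵢ(-)(dᵢ). -/
theorem MoritaBasis.of_inducedFunctor_faithful [Module.Finite A C] [Module.Projective A C]
    [Module.Finite Aᵐᵒᵖ C] [Module.Projective Aᵐᵒᵖ C] (h : (inducedFunctor A C).Faithful) :
    Nonempty (MoritaBasis A C) := by
  classical
  have := finitePresentation_rightDual (A := A) (C := C)
  obtain ⟨m, d, g, hg⟩ := exists_rightDualBasis (A := A) (C := C)
  -- n ⊗ d = 0 gives n ⊗ dᵢ = 0 for every i, and the dᵢ generate C as a right A-module, so n ⊗ c = 0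
  -- for every c.
  obtain ⟨φ, hφ⟩ := exists_linearMap_apply_eq_one (R := RightDual A C) d fun N _ _ n hn => by
    refine eq_zero_of_inducedFunctor_faithful h fun c => ?_
    have hd : ∀ i, tmul (RightDual A C) n (d i) = 0 := fun i => by
      have := congrArg (tensorMap LinearMap.id
        (LinearMap.proj i : (Fin m → C) →ₗ[RightDual A C] C)) hn
      rwa [tensorMap_tmul, map_zero] at this
    rw [← hg c, tmul_sum]
    refine Finset.sum_eq_zero fun i _ => ?_
    rw [← right_smul_tmul, hd, smul_zero]
  choose q hq using fun i => exists_toRightDual_eq (A := A)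
    (φ ∘ₗ LinearMap.single (RightDual A C) (fun _ : Fin m => C) i)
  refine MoritaBasis.of_sum_evalAt d q ?_
  rw [← hφ]
  conv_rhs => rw [← Finset.univ_sum_single d, _root_.map_sum]
  exact Finset.sum_congr rfl fun i _ => LinearMap.congr_fun (hq i) (d i)

end Coring

/-! ### Left comodules: C as a generator and the functor ^C Hom(C, -). -/

namespace Coring

open NCTensor

variable {A C : Type u} [Ring A] [AddCommGroup C] [Module A C] [Module Aᵐᵒᵖ C]
  [SMulCommClass A Aᵐᵒᵖ C] [Coring A C]

theorem contractLeft_add {N : Type*} [AddCommGroup N] [Module A N] (f g : RightDual A C)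
    (t : NCTensor A C N) :
    contractLeft (f + g).toLin t = contractLeft f.toLin t + contractLeft g.toLin t :=
  hom_congr (f := contractLeft (f + g).toLin)
    (g := contractLeft f.toLin + contractLeft g.toLin) (fun x y => by simp [add_smul]) t

theorem contractLeft_sum {N ι : Type*} [AddCommGroup N] [Module A N] (s : Finset ι)
    (f : ι → RightDual A C) (t : NCTensor A C N) :
    contractLeft (∑ i ∈ s, f i).toLin t = ∑ i ∈ s, contractLeft (f i).toLin t :=
  _root_.map_sum (AddMonoidHom.mk' (fun f : RightDual A C => contractLeft f.toLin t)
    fun f g => contractLeft_add f g t) f s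

theorem contractLeft_ofScalar_mul {N : Type*} [AddCommGroup N] [Module A N] (a : A)
    (f : RightDual A C) (t : NCTensor A C N) :
    contractLeft (RightDual.ofScalar a * f : RightDual A C).toLin t =
      a • contractLeft f.toLin t :=
  hom_congr (f := contractLeft (RightDual.ofScalar a * f : RightDual A C).toLin)
    (g := (DistribSMul.toAddMonoidHom N a).comp (contractLeft f.toLin))
    (fun x y => (congrArg (· • y) (RightDual.ofScalar_mul_apply a f x)).trans
      (mul_smul a (f x) y)) t

theorem contractLeft_smul {N : Type*} [AddCommGroup N] [Module A N] (a : A)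
    (f : RightDual A C) (t : NCTensor A C N) :
    contractLeft f.toLin (a • t) = contractLeft (f * RightDual.ofScalar a : RightDual A C).toLin t :=
  hom_congr (f := (contractLeft f.toLin).comp (DistribSMul.toAddMonoidHom (NCTensor A C N) a))
    (g := contractLeft (f * RightDual.ofScalar a : RightDual A C).toLin)
    (fun x y => (congrArg (· • y) (RightDual.mul_ofScalar_apply a f x)).symm) t

theorem contractLeft_assoc_comul {N : Type*} [AddCommGroup N] [Module A N]
    (f : RightDual A C) (t : NCTensor A C N) :
    contractLeft f.toLin (assoc (tensorMap (comulR A C) (LinearMap.id : N →ₗ[A] N) t)) =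
      tensorMap (actL f) (LinearMap.id : N →ₗ[A] N) t := by
  have h3 : ∀ (d : N) (s : NCTensor A C C), contractLeft f.toLin (assoc (tmul A s d)) =
      tmul A (contractLeft f.toLin s) d := fun d =>
    hom_congr (f := ((contractLeft f.toLin).comp assoc).comp ((mkHom A).flip d))
      (g := ((mkHom A).flip d).comp (contractLeft f.toLin)) fun x y => by simp
  exact hom_congr (f := ((contractLeft f.toLin).comp assoc).comp
      (tensorMap (comulR A C) (LinearMap.id : N →ₗ[A] N)))
    (g := tensorMap (actL f) (LinearMap.id : N →ₗ[A] N)) (fun x y => by simp [h3, actL_apply]) t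

theorem LeftComodule.coact_contractLeft (N : LeftComodule A C) (f : RightDual A C)
    (n : N.carrier) : N.coact (contractLeft f.toLin (N.coact n)) =
      tensorMap (actL f) LinearMap.id (N.coact n) := by
  rw [← contractLeft_assoc_comul, N.coassoc, contractLeft_tensorMap]
  rfl

/-- For `q` in `Q` and `t` in `C ⊗_A N`, the left `A`-linear map `C → N` that sends `c` to
`q(x)(c) n` if `t = x ⊗ n`. -/
def contractForm {N : Type*} [AddCommGroup N] [Module A N] (q : moritaQ A C)
    (t : NCTensor A C N) : C →ₗ[A] N where
  toFun c := contractLeft (evalAt q.1 c).toLin t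
  map_add' c d := by rw [evalAt_add, contractLeft_add]
  map_smul' a c := by
    rw [← actL_ofScalar, evalAt_actL, contractLeft_ofScalar_mul, RingHom.id_apply]

theorem contractForm_apply {N : Type*} [AddCommGroup N] [Module A N] (q : moritaQ A C)
    (t : NCTensor A C N) (c : C) :
    contractForm q t c = contractLeft (evalAt q.1 c).toLin t := rfl

theorem contractForm_add {N : Type*} [AddCommGroup N] [Module A N] (q : moritaQ A C)
    (s t : NCTensor A C N) : contractForm q (s + t) = contractForm q s + contractForm q t :=
  LinearMap.ext fun c => _root_.map_add (contractLeft (evalAt q.1 c).toLin) s t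

/-- For t = x ⊗ n this is the identity defining Q, tensored with n. It is what makes `formHom`
colinear. -/
theorem tensorMap_contractForm {N : Type*} [AddCommGroup N] [Module A N] (q : moritaQ A C)
    (t : NCTensor A C N) (c : C) :
    tensorMap LinearMap.id (contractForm q t) (comul (A := A) c) =
      tensorMap (actL (evalAt q.1 c)) (LinearMap.id : N →ₗ[A] N) t := by
  refine hom_congr (f := AddMonoidHom.mk' (fun t : NCTensor A C N =>
      tensorMap (LinearMap.id : C →ₗ[Aᵐᵒᵖ] C) (contractForm q t) (comul (A := A) c))
      fun s t => by rw [contractForm_add, tensorMap_add_right])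
    (g := tensorMap (actL (evalAt q.1 c)) (LinearMap.id : N →ₗ[A] N)) (fun x n => ?_) t
  rw [AddMonoidHom.mk'_apply, tensorMap_tmul, actL_evalAt, actR_apply]
  exact hom_congr
    (f := tensorMap (LinearMap.id : C →ₗ[Aᵐᵒᵖ] C) (contractForm q (tmul A x n)))
    (g := ((mkHom A).flip n).comp (NCTensor.contractRight (q.1 x).toLin))
    (fun y z => by simp [contractForm_apply, smul_tmul]) _

/-- For `q` in `Q` and `n` in a left comodule, the colinear map `c ↦ q(n₍₋₁₎)(c) n₍₀₎`. -/
def formHom (N : LeftComodule A C) (q : moritaQ A C) (n : N.carrier) :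
    LeftComodule.self A C ⟶ N :=
  ⟨contractForm q (N.coact n), fun c =>
    (N.coact_contractLeft _ n).trans (tensorMap_contractForm q (N.coact n) c).symm⟩

/-- The forms qᵢ(-)(cᵢ) add up to ε, so the sum is ε(n₍₋₁₎) n₍₀₎. Hence every element of a left
comodule is a finite sum of values of colinear maps from C. -/
theorem MoritaBasis.sum_formHom (b : MoritaBasis A C) (N : LeftComodule A C) (n : N.carrier) :
    ∑ i, (formHom N (b.form i) n).1 (b.elt i) = n := by
  refine (contractLeft_sum Finset.univ (fun i => evalAt (b.form i).1 (b.elt i))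
    (N.coact n)).symm.trans ?_
  rw [b.sum_evalAt]
  exact N.counital n

theorem MoritaBasis.leftComodule_hom_ext (b : MoritaBasis A C) {N N' : LeftComodule A C}
    {g g' : N ⟶ N'} (h : ∀ k : LeftComodule.self A C ⟶ N, k ≫ g = k ≫ g') : g = g' := by
  refine Subtype.ext (LinearMap.ext fun n => ?_)
  rw [← b.sum_formHom N n, _root_.map_sum, _root_.map_sum]
  exact Finset.sum_congr rfl fun i _ => congrArg
    (fun k : (LeftComodule.self A C).colin N' => k.1 (b.elt i)) (h (formHom N (b.form i) n))

theorem MoritaBasis.isSeparator (b : MoritaBasis A C) : IsSeparator (LeftComodule.self A C) :=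
  (isSeparator_def _).2 fun _ _ _ _ h => b.leftComodule_hom_ext h

theorem leftHomFunctor_faithful_iff :
    (leftHomFunctor A C).Faithful ↔ IsSeparator (LeftComodule.self A C) := by
  rw [isSeparator_def]
  refine ⟨fun h X Y f g hfg => h.map_injective (ModuleCat.hom_ext (LinearMap.ext hfg)),
    fun h => ⟨fun {X Y f g} hfg => h f g fun k => ?_⟩⟩
  exact congrArg (fun F => F.hom k) hfg

/-- Contracting the colinearity of φ with q(-)(d) gives φ(q(c₍₁₎)(d) c₍₂₎), which is φ(d · q(c)) by
the identity defining Q. -/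
theorem formHom_apply_hom {N : LeftComodule A C} (q : moritaQ A C)
    (φ : (LeftComodule.self A C).colin N) (c : C) :
    (show (LeftComodule.self A C).colin N from formHom N q (φ.1 c)) = q.1 c • φ := by
  refine Subtype.ext (LinearMap.ext fun d => ?_)
  have h := congrArg (contractLeft (evalAt q.1 d).toLin) (φ.2 c)
  rw [contractLeft_tensorMap] at h
  exact h.trans (congrArg φ.1 (actL_evalAt q c d))

theorem MoritaBasis.leftHomFunctor_full (b : MoritaBasis A C) : (leftHomFunctor A C).Full where
  map_surjective {N N'} Ψ := by
    let ψ : (LeftComodule.self A C).colin N →ₗ[LeftDual A C] (LeftComodule.self A C).colin N' :=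
      Ψ.hom
    -- Forced by n = ∑ kᵢ(cᵢ) with kᵢ = `formHom` of qᵢ and n: a preimage of ψ must send kᵢ(cᵢ) to
    -- ψ(kᵢ)(cᵢ).
    let g : N.carrier → N'.carrier := fun n => ∑ i, (ψ (formHom N (b.form i) n)).1 (b.elt i)
    have hg : ∀ (φ : (LeftComodule.self A C).colin N) (c : C), g (φ.1 c) = (ψ φ).1 c := by
      intro φ c
      have h1 : ∀ i, (ψ (formHom N (b.form i) (φ.1 c))).1 (b.elt i) =
          (ψ φ).1 (actR ((b.form i).1 c) (b.elt i)) := fun i => by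
        have h2 : ψ (formHom N (b.form i) (φ.1 c)) = (b.form i).1 c • ψ φ :=
          (congrArg ψ (formHom_apply_hom (b.form i) φ c)).trans (_root_.map_smul ψ _ _)
        rw [h2]
        rfl
      refine (Finset.sum_congr rfl fun i _ => h1 i).trans ?_
      rw [← _root_.map_sum, b.sum_actR]
    have hadd : ∀ m n, g (m + n) = g m + g n := fun m n => by
      have h1 : ∀ q : moritaQ A C, (formHom N q (m + n) : (LeftComodule.self A C).colin N) =
          (show (LeftComodule.self A C).colin N from formHom N q m) + formHom N q n := fun q =>
        Subtype.ext (by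
          refine Eq.trans ?_ (contractForm_add q (N.coact m) (N.coact n))
          rw [← _root_.map_add]
          rfl)
      simp only [g, h1, _root_.map_add, ← Finset.sum_add_distrib]
      rfl
    let G : N.carrier →+ N'.carrier := AddMonoidHom.mk' g hadd
    -- Values of colinear maps C → N span N additively, so A-linearity and colinearity need checking
    -- only on elements φ(c), where g is given by ψ(φ).
    have hspan : ∀ {P : N.carrier → Prop}, (∀ m n, P m → P n → P (m + n)) → P 0 →
        (∀ (φ : (LeftComodule.self A C).colin N) (c : C), P (φ.1 c)) → ∀ n, P n := by
      intro P h1 h0 h2 n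
      rw [← b.sum_formHom N n]
      exact Finset.sum_induction _ P h1 h0 fun i _ => h2 _ _
    have hsmul : ∀ (a : A) (n : N.carrier), G (a • n) = a • G n := fun a n => by
      refine hspan (P := fun n => G (a • n) = a • G n) (fun m n hm hn => ?_) (by simp)
        (fun φ c => ?_) n
      · rw [smul_add, _root_.map_add, hm, hn, _root_.map_add, smul_add]
      · have h1 : a • φ.1 c = φ.1 (a • c) := (_root_.map_smul φ.1 a c).symm
        rw [h1]
        refine (hg φ (a • c)).trans ?_
        refine (_root_.map_smul (ψ φ).1 a c).trans ?_
        exact congrArg (a • ·) (hg φ c).symm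
    let G' : N.carrier →ₗ[A] N'.carrier :=
      { toFun := G, map_add' := _root_.map_add G, map_smul' := hsmul }
    have hG' : ∀ φ : (LeftComodule.self A C).colin N, G' ∘ₗ φ.1 = (ψ φ).1 := fun φ =>
      LinearMap.ext fun c => hg φ c
    have hco : ∀ n, N'.coact (G' n) = tensorMap LinearMap.id G' (N.coact n) := fun n => by
      refine hspan (P := fun n => N'.coact (G' n) = tensorMap LinearMap.id G' (N.coact n))
        (fun m n hm hn => ?_) (by simp) (fun φ c => ?_) n
      · simp only [_root_.map_add, hm, hn]
      · rw [φ.2 c, tensorMap_comp, hG']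
        exact (congrArg N'.coact (hg φ c)).trans ((ψ φ).2 c)
    exact ⟨⟨G', hco⟩, ModuleCat.hom_ext (LinearMap.ext fun φ => Subtype.ext (hG' φ))⟩

/-! ### Left comodules from left `C*`-modules -/

theorem eq_sum_tmul_contractLeft {A C N : Type*} [Ring A] [AddCommGroup C] [Module Aᵐᵒᵖ C]
    [AddCommGroup N] [Module A N] {n : ℕ} (e : Fin n → C) (f : Fin n → RightDual A C)
    (hf : ∀ x, ∑ i, op (f i x) • e i = x) (t : NCTensor A C N) :
    ∑ i, tmul A (e i) (contractLeft (f i).toLin t) = t := by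
  have := hom_congr (f := ∑ i, (mkHom A (e i)).comp (contractLeft (f i).toLin))
    (g := AddMonoidHom.id (NCTensor A C N)) (fun x y => by
      simp only [AddMonoidHom.finsetSum_apply, AddMonoidHom.comp_apply, mkHom_apply,
        contractLeft_tmul, ← smul_tmul, AddMonoidHom.id_apply]
      rw [← sum_tmul]
      exact congrArg (fun z => tmul A z y) (hf x)) t
  simpa using this

/-- A right dual basis recovers t as ∑ eᵢ ⊗ fᵢ(t), so identities in C ⊗_A N can be tested in N by
contraction. -/
theorem eq_of_contractLeft_eq {A C : Type*} [Ring A] [AddCommGroup C] [Module Aᵐᵒᵖ C]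
    [Module.Finite Aᵐᵒᵖ C] [Module.Projective Aᵐᵒᵖ C] {N : Type*} [AddCommGroup N]
    [Module A N] {s t : NCTensor A C N}
    (h : ∀ f : RightDual A C, contractLeft f.toLin s = contractLeft f.toLin t) : s = t := by
  obtain ⟨n, e, f, hf⟩ := exists_rightDualBasis (A := A) (C := C)
  rw [← eq_sum_tmul_contractLeft e f hf s, ← eq_sum_tmul_contractLeft e f hf t]
  simp only [h]

/-- The coaction is m ↦ ∑ eᵢ ⊗ fᵢ m for a right dual basis; contraction with g gives g m because g =
∑ g(eᵢ) fᵢ in C*. -/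
theorem exists_coact [Module.Finite Aᵐᵒᵖ C] [Module.Projective Aᵐᵒᵖ C] {M : Type*}
    [AddCommGroup M] [Module A M] [Module (RightDual A C) M]
    (hM : ∀ (a : A) (m : M), (RightDual.ofScalar a : RightDual A C) • m = a • m) :
    ∃ ρ : M →ₗ[A] NCTensor A C M, ∀ (f : RightDual A C) (m : M),
      contractLeft f.toLin (ρ m) = f • m := by
  obtain ⟨n, e, f, hf⟩ := exists_rightDualBasis (A := A) (C := C)
  have key : ∀ (g : RightDual A C) (m : M),
      contractLeft g.toLin (∑ i, tmul A (e i) (f i • m)) = g • m := fun g m => by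
    have hg : g = ∑ i, RightDual.ofScalar (g (e i)) * f i := by
      ext x
      conv_lhs => rw [← hf x, RightDual.map_sum]
      simp [RightDual.sum_apply, RightDual.ofScalar_mul_apply]
    conv_rhs => rw [hg, Finset.sum_smul]
    simp [mul_smul, hM]
  refine ⟨{ toFun := fun m => ∑ i, tmul A (e i) (f i • m)
            map_add' := fun m m' => eq_of_contractLeft_eq fun g => ?_
            map_smul' := fun a m => eq_of_contractLeft_eq fun g => ?_ }, key⟩
  · rw [key, _root_.map_add, key, key, smul_add]
  · rw [key, RingHom.id_apply, contractLeft_smul, key, mul_smul, hM]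

/-- The left `A`-module structure of a left `C*`-module. -/
abbrev moduleOfRightDual (A C : Type u) [Ring A] [AddCommGroup C] [Module A C] [Module Aᵐᵒᵖ C]
    [SMulCommClass A Aᵐᵒᵖ C] [Coring A C] (M : Type*) [AddCommGroup M]
    [Module (RightDual A C) M] : Module A M :=
  Module.compHom M (ofScalarHom A C)

/-- A left `C*`-module as a left `C`-comodule, if `C` is finitely generated and projective as a
right `A`-module. -/
noncomputable def LeftComodule.ofModule [Module.Finite Aᵐᵒᵖ C] [Module.Projective Aᵐᵒᵖ C] (M : Type u)
    [AddCommGroup M] [Module (RightDual A C) M] : LeftComodule A C :=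
  letI := moduleOfRightDual A C M
  have h := (exists_coact (A := A) (C := C) (M := M) fun _ _ => rfl).choose_spec
  { carrier := M
    coact := (exists_coact (A := A) (C := C) (M := M) fun _ _ => rfl).choose
    -- After contraction with two forms, coassociativity becomes associativity (k * g) m = k (g m)
    -- of the action.
    coassoc := fun m => eq_of_contractLeft_eq fun g => eq_of_contractLeft_eq fun k => by
      rw [contractLeft_assoc_comul, contractLeft_tensorMap, contractLeft_tensorMap]
      refine Eq.trans ?_ (h k _).symm
      refine (h (k * g) m).trans ?_
      refine (mul_smul k g m).trans (congrArg (k • ·) (h g m).symm)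
    counital := fun m => (h 1 m).trans (one_smul _ m) }

section

variable [Module.Finite Aᵐᵒᵖ C] [Module.Projective Aᵐᵒᵖ C] (M : Type u)
  [AddCommGroup M] [Module (RightDual A C) M]

theorem LeftComodule.contractLeft_ofModule (f : RightDual A C) (m : M) :
    contractLeft f.toLin ((LeftComodule.ofModule (A := A) (C := C) M).coact m) = f • m :=
  letI := moduleOfRightDual A C M
  (exists_coact (A := A) (C := C) (M := M) fun _ _ => rfl).choose_spec f m

variable {M} in
/-- A left `C*`-linear map as a colinear map. -/
noncomputable def LeftComodule.ofModuleMap {M' : Type u} [AddCommGroup M'] [Module (RightDual A C) M']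
    (g : M →ₗ[RightDual A C] M') :
    LeftComodule.ofModule (A := A) (C := C) M ⟶ LeftComodule.ofModule (A := A) (C := C) M' :=
  letI := moduleOfRightDual A C M
  letI := moduleOfRightDual A C M'
  let g' : M →ₗ[A] M' :=
    { toFun := g
      map_add' := _root_.map_add g
      map_smul' := fun a m => _root_.map_smul g (RightDual.ofScalar a) m }
  ⟨g', fun (m : M) => eq_of_contractLeft_eq fun f => by
    refine (LeftComodule.contractLeft_ofModule M' f (g m)).trans ?_
    refine Eq.trans ?_ (contractLeft_tensorMap _ _ _ _).symm
    have h : f • g m = g (f • m) := (_root_.map_smul g f m).symm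
    exact h.trans <| congrArg g (LeftComodule.contractLeft_ofModule M f m).symm⟩

variable {M} in
/-- A colinear map `C → M` as a left `C*`-linear map. -/
noncomputable def LeftComodule.homOfModule (g : LeftComodule.self A C ⟶ LeftComodule.ofModule (A := A) M) :
    C →ₗ[RightDual A C] M where
  toFun c := (g.1 c : M)
  map_add' := _root_.map_add g.1
  map_smul' f c := by
    have h := congrArg (contractLeft f.toLin) (g.2 c)
    rw [contractLeft_tensorMap] at h
    have h' : ∀ m : M, contractLeft f.toLin
        ((LeftComodule.ofModule (A := A) (C := C) M).coact m) = f • m :=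
      LeftComodule.contractLeft_ofModule M f
    exact h.symm.trans (h' (g.1 c))

end

variable (A C) in
/-- The left ideal of `C*` of all finite sums of elements `x ↦ q(x)(c)`. -/
def traceIdeal : Submodule (RightDual A C) (RightDual A C) where
  carrier := {t | ∃ (n : ℕ) (c : Fin n → C) (q : Fin n → moritaQ A C),
    t = ∑ i, evalAt (q i).1 (c i)}
  zero_mem' := ⟨0, Fin.elim0, Fin.elim0, by simp⟩
  add_mem' := by
    rintro _ _ ⟨n, c, q, rfl⟩ ⟨n', c', q', rfl⟩
    exact ⟨n + n', Fin.append c c', Fin.append q q', by simp [Fin.sum_univ_add]⟩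
  smul_mem' := by
    rintro f _ ⟨n, c, q, rfl⟩
    exact ⟨n, fun i => actL f (c i), q, by simp [Finset.mul_sum, evalAt_actL]⟩

/-- Every colinear map C → C* is c ↦ q(-)(c) for some q in Q, so it lands in the trace ideal T. The
quotient map C* → C*/T is therefore indistinguishable from zero by maps out of C, and 1 lies in T.
-/
theorem MoritaBasis.of_isSeparator [Module.Finite Aᵐᵒᵖ C] [Module.Projective Aᵐᵒᵖ C]
    (h : IsSeparator (LeftComodule.self A C)) : Nonempty (MoritaBasis A C) := by
  have h0 := (isSeparator_def _).1 h (LeftComodule.ofModuleMap (traceIdeal A C).mkQ)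
    (LeftComodule.ofModuleMap 0) fun k => Subtype.ext (LinearMap.ext fun c => by
      obtain ⟨q, hq⟩ := exists_toRightDual_eq (LeftComodule.homOfModule k)
      refine (Submodule.Quotient.mk_eq_zero (traceIdeal A C)).2 ?_
      exact ⟨1, fun _ => c, fun _ => q, by
        rw [Fin.sum_univ_one]
        exact (LinearMap.congr_fun hq c).symm⟩)
  have h1 : (traceIdeal A C).mkQ 1 = 0 := congrArg
    (fun k : (LeftComodule.ofModule (A := A) (C := C) (RightDual A C)).colin
      (LeftComodule.ofModule (RightDual A C ⧸ traceIdeal A C)) => k.1 (1 : RightDual A C)) h0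
  obtain ⟨n, c, q, hcq⟩ := (Submodule.Quotient.mk_eq_zero _).1 h1
  exact MoritaBasis.of_sum_evalAt c q hcq.symm

end Coring

/-! ### Flatness and projectivity of C over *C. -/

namespace NCTensor

variable {R M N : Type*} [Ring R] [AddCommGroup M] [AddCommGroup N] [Module Rᵐᵒᵖ M] [Module R N]

/-- Right exactness of `M ⊗_R -`. -/
theorem exists_of_tensorMap_mkQ_eq_zero (K : Submodule R N) (t : NCTensor R M N)
    (ht : tensorMap (LinearMap.id : M →ₗ[Rᵐᵒᵖ] M) K.mkQ t = 0) :
    ∃ s : NCTensor R M K, tensorMap (LinearMap.id : M →ₗ[Rᵐᵒᵖ] M) K.subtype s = t := by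
  let P := (tensorMap (LinearMap.id : M →ₗ[Rᵐᵒᵖ] M) K.subtype).range
  -- An inverse modulo the image P: m ⊗ (n + K) goes to the class of m ⊗ n, which is well defined
  -- since M ⊗ K maps into P.
  let F : M → (N ⧸ K) →+ NCTensor R M N ⧸ P := fun m =>
    QuotientAddGroup.lift K.toAddSubgroup ((QuotientAddGroup.mk' P).comp (mkHom R m))
      fun n hn => (QuotientAddGroup.eq_zero_iff _).2 ⟨tmul R m ⟨n, hn⟩, rfl⟩
  have hF : ∀ m n, F m (K.mkQ n) = QuotientAddGroup.mk' P (tmul R m n) := fun _ _ => rfl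
  let G : M →+ (N ⧸ K) →+ NCTensor R M N ⧸ P := AddMonoidHom.mk' F fun m m' => by
    ext n
    obtain ⟨n, rfl⟩ := K.mkQ_surjective n
    rw [AddMonoidHom.add_apply, hF, hF, hF, add_tmul, map_add]
  let L : NCTensor R M (N ⧸ K) →+ NCTensor R M N ⧸ P := lift G fun r m n => by
    obtain ⟨n, rfl⟩ := K.mkQ_surjective n
    rw [← map_smul]
    exact (hF _ _).trans ((congrArg _ (smul_tmul R r m n)).trans (hF _ _).symm)
  have hL : L (tensorMap (LinearMap.id : M →ₗ[Rᵐᵒᵖ] M) K.mkQ t) = QuotientAddGroup.mk' P t :=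
    hom_congr (f := L.comp (tensorMap (LinearMap.id : M →ₗ[Rᵐᵒᵖ] M) K.mkQ))
      (g := QuotientAddGroup.mk' P) (fun m n => hF m n) t
  rw [ht, map_zero] at hL
  exact (QuotientAddGroup.eq_zero_iff t).1 hL.symm

end NCTensor

open NCTensor in
/-- A finitely presented flat right module is projective. -/
theorem IsRightFlat.projective {R M : Type u} [Ring R] [AddCommGroup M] [Module Rᵐᵒᵖ M]
    [Module.FinitePresentation Rᵐᵒᵖ M] (h : IsRightFlat R M) : Module.Projective Rᵐᵒᵖ M := by
  classical
  obtain ⟨l, k, f, g, hf, hfg⟩ := Module.FinitePresentation.exists_fin' Rᵐᵒᵖ M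
  let w : Fin k → Fin l → R := fun j i => unop (g (Pi.single j 1) i)
  let e : Fin l → M := fun i => f (Pi.single i 1)
  have hm : ∀ v : Fin l → Rᵐᵒᵖ, f v = ∑ i, v i • e i := fun v => by
    conv_lhs => rw [pi_eq_sum_univ' v]
    simp [e]
  have hw : ∀ j, ∑ i, op (w j i) • e i = 0 := fun j =>
    (hm _).symm.trans (hfg.apply_apply_eq_zero _)
  let W : (Fin l → R) →ₗ[R] (Fin k → R) := Fintype.linearCombination R fun i j => w j i
  have hW : ∀ v j, W v j = ∑ i, v i * w j i := fun v j => by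
    simp [W, Fintype.linearCombination_apply, Finset.sum_apply]
  let K := LinearMap.ker W
  let t : NCTensor R M (Fin l → R) := ∑ i, tmul R (e i) (Pi.single i 1)
  -- Flatness is applied to Rˡ/K ↪ Rᵏ. In M ⊗ Rᵏ the tensor t becomes ∑ⱼ (∑ᵢ eᵢ wⱼᵢ) ⊗ 1ⱼ, which
  -- vanishes by the relations of M.
  have ht : tensorMap (LinearMap.id : M →ₗ[Rᵐᵒᵖ] M) K.mkQ t = 0 := by
    refine h _ _ (K.liftQ W le_rfl)
      (LinearMap.ker_eq_bot.1 (Submodule.ker_liftQ_eq_bot _ _ _ le_rfl)) ?_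
    rw [tensorMap_comp, Submodule.liftQ_mkQ, map_zero, map_sum]
    have h1 : ∀ i, W (Pi.single i 1) = ∑ j, w j i • (Pi.single j 1 : Fin k → R) := fun i => by
      ext j
      simp [hW, Pi.single_apply, Finset.sum_apply]
    simp only [tensorMap_tmul, h1, tmul_sum, ← smul_tmul]
    rw [Finset.sum_comm]
    refine Finset.sum_eq_zero fun j _ => ?_
    rw [← sum_tmul]
    exact (congrArg (fun z => tmul R z _) (hw j)).trans (zero_tmul R _)
  obtain ⟨s, hs⟩ := exists_of_tensorMap_mkQ_eq_zero K t ht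
  obtain ⟨n, y, b, rfl⟩ := Coring.exists_sum_tmul s
  -- So t comes from M ⊗ K, and reading off coordinates gives eᵢ = ∑ yₐ bₐᵢ with each bₐ annihilated
  -- by all the relations.
  have hy : ∀ i, e i = ∑ a, op ((b a : Fin l → R) i) • y a := fun i => by
    have := congrArg (NCTensor.contractRight (LinearMap.proj i : (Fin l → R) →ₗ[R] R)) hs
    simp only [map_sum, tensorMap_tmul, contractRight_tmul, t] at this
    simpa [Pi.single_apply, ite_smul, apply_ite op] using this.symm
  -- The matrix b factors f as p ∘ ψ with ψ zero on ker f; the map induced by ψ on M is then a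
  -- section of p.
  let ψ : (Fin l → Rᵐᵒᵖ) →ₗ[Rᵐᵒᵖ] (Fin n → Rᵐᵒᵖ) :=
    Fintype.linearCombination Rᵐᵒᵖ fun i a => op ((b a : Fin l → R) i)
  have hψ : LinearMap.ker f ≤ LinearMap.ker ψ := fun x hx => by
    obtain ⟨z, rfl⟩ := (hfg x).1 hx
    rw [LinearMap.mem_ker, pi_eq_sum_univ' z]
    have : ∀ j, ψ (g (Pi.single j 1)) = 0 := fun j => by
      ext1 a
      have h2 := congrFun (LinearMap.mem_ker.1 (b a).2) j
      rw [hW] at h2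
      refine unop_injective ?_
      simpa [ψ, Fintype.linearCombination_apply, Finset.sum_apply] using h2
    simp [this]
  let p : (Fin n → Rᵐᵒᵖ) →ₗ[Rᵐᵒᵖ] M := Fintype.linearCombination Rᵐᵒᵖ y
  have hp : ∀ v, p (ψ v) = f v := fun v => by
    rw [hm]
    simp only [hy, p, ψ, Fintype.linearCombination_apply, Finset.sum_apply, Pi.smul_apply,
      smul_eq_mul, Finset.sum_smul, Finset.smul_sum, mul_smul]
    exact Finset.sum_comm
  refine Module.Projective.of_split
    ((LinearMap.ker f).liftQ ψ hψ ∘ₗ (f.quotKerEquivOfSurjective hf).symm.toLinearMap) p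
    (LinearMap.ext fun x => ?_)
  obtain ⟨v, rfl⟩ := hf x
  have h3 : (f.quotKerEquivOfSurjective hf).symm (f v) = (LinearMap.ker f).mkQ v := by
    rw [LinearEquiv.symm_apply_eq]
    rfl
  rw [LinearMap.comp_apply, LinearMap.comp_apply, LinearEquiv.coe_coe, h3, Submodule.mkQ_apply,
    Submodule.liftQ_apply, hp]
  rfl

namespace Coring

open NCTensor

variable {A C : Type u} [Ring A] [AddCommGroup C] [Module A C] [Module Aᵐᵒᵖ C]
  [SMulCommClass A Aᵐᵒᵖ C] [Coring A C]

/-- Every t in C ⊗ N equals ∑ cᵢ ⊗ qᵢ(t) with qᵢ(t) in N, naturally in N. If f is injective and t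
maps to zero, all the qᵢ(t) vanish. -/
theorem MoritaBasis.isRightFlat (b : MoritaBasis A C) : IsRightFlat (LeftDual A C) C := by
  intro N N' _ _ _ _ f hf
  have key : ∀ t : NCTensor (LeftDual A C) C N,
      ∑ i, tmul (LeftDual A C) (b.elt i) (contractLeft (toLeftDual (b.form i)) t) = t := fun t => by
    have := hom_congr (f := ∑ i, (mkHom (LeftDual A C) (b.elt i)).comp
        (contractLeft (toLeftDual (b.form i))))
      (g := AddMonoidHom.id (NCTensor (LeftDual A C) C N)) (fun x y => by
        simp only [AddMonoidHom.finsetSum_apply, AddMonoidHom.comp_apply, mkHom_apply,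
          contractLeft_tmul, ← smul_tmul, AddMonoidHom.id_apply]
        rw [← sum_tmul]
        exact congrArg (fun z => tmul (LeftDual A C) z y) (b.sum_actR x)) t
    simpa using this
  refine (injective_iff_map_eq_zero _).2 fun t ht => ?_
  rw [← key t]
  refine Finset.sum_eq_zero fun i _ => ?_
  have h1 := congrArg (contractLeft (toLeftDual (b.form i))) ht
  rw [contractLeft_tensorMap, _root_.map_zero, LinearMap.comp_id] at h1
  rw [hf (h1.trans (_root_.map_zero f).symm), tmul_zero]

theorem isLeftQuasiFrobenius_of_projective [Module.Finite (LeftDual A C)ᵐᵒᵖ C]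
    [Module.Projective (LeftDual A C)ᵐᵒᵖ C] : IsLeftQuasiFrobenius A C := by
  obtain ⟨n, p, i, -, -, hpi⟩ :=
    Module.Finite.exists_comp_eq_id_of_projective (LeftDual A C)ᵐᵒᵖ C
  refine ⟨n,
    { toFun := fun c k => unop (i c k)
      map_add' := fun c d => by ext1 k; simp
      map_smul' := fun a c => by ext1 k; rw [_root_.map_smul]; rfl },
    { toFun := fun v => p fun k => op (v k)
      map_add' := fun v w => (_root_.map_add p _ _).symm ▸ rfl
      map_smul' := fun a v => (_root_.map_smul p a _).symm ▸ rfl }, ?_⟩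
  exact LinearMap.ext fun c => LinearMap.congr_fun hpi c

theorem IsLeftQuasiFrobenius.of_isRightFlat [Module.Finite A C] [Module.Projective A C]
    [Module.Finite Aᵐᵒᵖ C] [Module.Projective Aᵐᵒᵖ C] (h : IsRightFlat (LeftDual A C) C) :
    IsLeftQuasiFrobenius A C := by
  have := finitePresentation_leftDual (A := A) (C := C)
  have := h.projective
  exact isLeftQuasiFrobenius_of_projective

end Coring

theorem corollary4p7 {A C : Type u} [Ring A] [AddCommGroup C] [Module A C] [Module Aᵐᵒᵖ C]
    [SMulCommClass A Aᵐᵒᵖ C] [Coring A C]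
    (hfin : Module.Finite A C) (hproj : Module.Projective A C) :
    List.TFAE
      [Coring.IsLeftQuasiFrobenius A C,
       (Module.Finite Aᵐᵒᵖ C ∧ Module.Projective Aᵐᵒᵖ C) ∧
         Function.Surjective (Coring.triangle A C),
       (Module.Finite Aᵐᵒᵖ C ∧ Module.Projective Aᵐᵒᵖ C) ∧
         Function.Bijective (Coring.triangle A C),
       (Module.Finite Aᵐᵒᵖ C ∧ Module.Projective Aᵐᵒᵖ C) ∧
         (Coring.inducedFunctor A C).Full ∧ (Coring.inducedFunctor A C).Faithful,
       (Module.Finite Aᵐᵒᵖ C ∧ Module.Projective Aᵐᵒᵖ C) ∧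
         IsSeparator (Coring.LeftComodule.self A C),
       (Module.Finite Aᵐᵒᵖ C ∧ Module.Projective Aᵐᵒᵖ C) ∧
         IsRightFlat (Coring.LeftDual A C) C,
       (Module.Finite Aᵐᵒᵖ C ∧ Module.Projective Aᵐᵒᵖ C) ∧
         (Coring.leftHomFunctor A C).Full ∧ (Coring.leftHomFunctor A C).Faithful] := by
  -- The only implication out of statement 1 that needs work; every other one reads its conclusion
  -- off the basis.
  have hub : Coring.IsLeftQuasiFrobenius A C → Nonempty (Coring.MoritaBasis A C) :=
    Coring.MoritaBasis.of_isLeftQuasiFrobenius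
  tfae_have 1 → 3 := fun h => (hub h).elim fun b => ⟨b.rightFinite, b.triangle_bijective⟩
  tfae_have 3 → 2 := fun h => ⟨h.1, h.2.2⟩
  tfae_have 2 → 1 := fun h =>
    (Coring.MoritaBasis.of_triangle_surjective h.2).elim fun b => b.isLeftQuasiFrobenius
  tfae_have 1 → 4 := fun h => (hub h).elim fun b =>
    ⟨b.rightFinite, b.inducedFunctor_full, b.inducedFunctor_faithful⟩
  tfae_have 4 → 1 := fun ⟨⟨_, _⟩, _, h⟩ =>
    (Coring.MoritaBasis.of_inducedFunctor_faithful h).elim fun b => b.isLeftQuasiFrobenius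
  tfae_have 1 → 7 := fun h => (hub h).elim fun b =>
    ⟨b.rightFinite, b.leftHomFunctor_full, Coring.leftHomFunctor_faithful_iff.2 b.isSeparator⟩
  tfae_have 7 → 5 := fun h => ⟨h.1, Coring.leftHomFunctor_faithful_iff.1 h.2.2⟩
  tfae_have 5 → 1 := fun ⟨⟨_, _⟩, h⟩ =>
    (Coring.MoritaBasis.of_isSeparator h).elim fun b => b.isLeftQuasiFrobenius
  tfae_have 1 → 6 := fun h => (hub h).elim fun b => ⟨b.rightFinite, b.isRightFlat⟩
  tfae_have 6 → 1 := fun ⟨⟨_, _⟩, h⟩ => Coring.IsLeftQuasiFrobenius.of_isRightFlat h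
  tfae_finish
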